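/- All rings are commutative with identity, and heights and grades take values in $\mathbb{N}\cup\{\infty\}$ with $\inf\emptyset=\infty$; in particular $\operatorname{ht}(A)=\infty$ for the unit ideal of a ring $A$. **Definitions.** Let $A$ be a ring. *Koszul grade.* For a finite sequence $\underline{x}=x_1,\dots,x_r$ in $A$ with Koszul complex $\mathbb{K}_\bullet(\underline{x})$ and an $A$-module $M$, let $\operatorname{K.grade}_A(\underline{x},M)=\inf\{i\ge 0 : H^i(\operatorname{Hom}_A(\mathbb{K}_\bullet(\underline{x}),M))\ne 0\}$. For an ideal $\mathfrak{a}$ of $A$, $\operatorname{K.grade}_A(\mathfrak{a},M)$ is the supremum of $\operatorname{K.grade}_A(\underline{x},M)$ over all finite sequences $\underline{x}$ of elements of $\mathfrak{a}$. *Parameter sequences.* For $m\ge n$ let $\varphi^m_n:\mathbb{K}_\bullet(x_1^m,\dots,x_r^m)\to\mathbb{K}_\bullet(x_1^n,\dots,x_r^n)$ be the chain map $e_I\mapsto(\prod_{k\in I}x_k)^{m-n}e_I$. The sequence $\underline{x}$ is *weakly proregular* if for each $n>0$ there is $m\ge n$ such that $H_i(\varphi^m_n)=0$ for all $i\ge1$.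 It is a *parameter sequence* if it is weakly proregular, $(\underline{x})\ne A$, and $H^r_{\underline{x}}(A)_{\mathfrak{p}}\ne0$ for all primes $\mathfrak{p}\supseteq(\underline{x})$, where $H^r_{\underline{x}}$ denotes \v{C}ech cohomology. It is a *strong parameter sequence* if $r\ge1$ and $x_1,\dots,x_i$ is a parameter sequence for all $1\le i\le r$. It is a *regular sequence* if $x_i$ is a nonzerodivisor on $A/(x_1,\dots,x_{i-1})$ for $i=1,\dots,r$ and $(\underline{x})\ne A$. *Weakly associated primes.* $\operatorname{wAss}_A(M)$ is the set of primes of $A$ that are minimal over $(0:_A m)$ for some $m\in M$. For an ideal $\mathfrak{a}$, $\min(\mathfrak{a})$ is the set of primes minimal over $\mathfrak{a}$, and for $\mathfrak{a}$ finitely generated $\mu(\mathfrak{a})$ is the minimal number of generators of $\mathfrak{a}$. *Noetherian Cohen-Macaulay.* A Noetherian ring $R$ is Cohen-Macaulay if $\operatorname{depth}R_{\mathfrak{m}}=\dim R_{\mathfrak{m}}$ for every maximal ideal $\mathfrak{m}$ of $R$, the depth of a local ring being the supremum of the lengths of regular sequences in its maximal ideal. **Theorem.** Let $R$ be a Noetherian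 Cohen-Macaulay ring and let $A=R[X_1,X_2,\dots]$ be the polynomial ring in countably infinitely many variables. Then: 1. (prime ideals) $\operatorname{ht}\mathfrak{p}=\operatorname{K.grade}_A(\mathfrak{p},A)$ for every prime ideal $\mathfrak{p}$ of $A$; 2. (ideals) $\operatorname{ht}\mathfrak{a}=\operatorname{K.grade}_A(\mathfrak{a},A)$ for every ideal $\mathfrak{a}$ of $A$; 3. (Glaz) $\operatorname{ht}\mathfrak{p}=\operatorname{K.grade}_{A_{\mathfrak{p}}}(\mathfrak{p}A_{\mathfrak{p}},A_{\mathfrak{p}})$ for every prime ideal $\mathfrak{p}$ of $A$; 4. (finitely generated ideals) $\operatorname{ht}\mathfrak{a}=\operatorname{K.grade}_A(\mathfrak{a},A)$ for every finitely generated ideal $\mathfrak{a}$ of $A$; 5. (Hamilton-Marley) every strong parameter sequence on $A$ is a regular sequence on $A$; 6. (weak Bourbaki unmixed) $\min(\mathfrak{a})=\operatorname{wAss}_A(A/\mathfrak{a})$ for every finitely generated ideal $\mathfrak{a}$ of $A$ with $\operatorname{ht}\mathfrak{a}\ge\mu(\mathfrak{a})$; 7. (maximal ideals) $\operatorname{ht}\mathfrak{m}=\operatorname{K.grade}_A(\mathfrak{m},A)$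 for every maximal ideal $\mathfrak{m}$ of $A$. -/

import Mathlib

namespace NonNoethCM

noncomputable section

universe u v

/-! ### Homology of a pair of composable linear maps -/

section Homology

variable {R : Type u} [CommRing R]
variable {A B C A' B' C' : Type*}
  [AddCommGroup A] [Module R A] [AddCommGroup B] [Module R B] [AddCommGroup C] [Module R C]
  [AddCommGroup A'] [Module R A'] [AddCommGroup B'] [Module R B'] [AddCommGroup C'] [Module R C']

/-- The homology `ker g / im f` of `A --f--> B --g--> C`. -/
abbrev Homology (f : A →ₗ[R] B) (g : B →ₗ[R] C) : Type _ :=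
  LinearMap.ker g ⧸ (LinearMap.range f).submoduleOf (LinearMap.ker g)

/-- The map on homology induced by a morphism `(α, β, γ)` between two composable pairs. -/
def homologyMap {f : A →ₗ[R] B} {g : B →ₗ[R] C} {f' : A' →ₗ[R] B'} {g' : B' →ₗ[R] C'}
    (α : A →ₗ[R] A') (β : B →ₗ[R] B') (γ : C →ₗ[R] C')
    (hf : β ∘ₗ f = f' ∘ₗ α) (hg : γ ∘ₗ g = g' ∘ₗ β) : Homology f g →ₗ[R] Homology f' g' :=
  Submodule.mapQ _ _
    (β.restrict (p := LinearMap.ker g) (q := LinearMap.ker g') (fun b hb => by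
      have h := LinearMap.congr_fun hg b
      simp only [LinearMap.comp_apply, LinearMap.mem_ker] at h hb ⊢
      rw [← h, hb, map_zero]))
    (by
      rintro ⟨b, hb⟩ ⟨a, ha⟩
      refine ⟨α a, ?_⟩
      have h := LinearMap.congr_fun hf a
      simp only [LinearMap.comp_apply, Submodule.subtype_apply] at h ha
      rw [← h, ha]
      rfl)

end Homology

/-! ### The Koszul complex -/

section Koszul

variable {R : Type u} [CommRing R] {r : ℕ}

/-- The subsets of `{0, …, r - 1}` with `i` elements. -/
abbrev Subsets (r i : ℕ) : Type := {I : Finset (Fin r) // I.card = i}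

/-- `J ∪ {j}` for `j ∉ J`. -/
def Subsets.insert {i : ℕ} (J : Subsets r i) (j : {j : Fin r // j ∉ J.1}) : Subsets r (i + 1) :=
  ⟨Insert.insert j.1 J.1, by rw [Finset.card_insert_of_notMem j.2, J.2]⟩

/-- `J \ {j}` for `j ∈ J`. -/
def Subsets.erase {i : ℕ} (J : Subsets r (i + 1)) (j : {j : Fin r // j ∈ J.1}) : Subsets r i :=
  ⟨J.1.erase j.1, by rw [Finset.card_erase_of_mem j.2, J.2, Nat.add_sub_cancel]⟩

/-- The number of elements of `J` that are smaller than `j`. -/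
def position (J : Finset (Fin r)) (j : Fin r) : ℕ := (J.filter (· < j)).card

/-- The module of Koszul chains of degree `i` on `r` elements: the free module with basis `e_I`,
`I` running over the subsets of `{0, …, r - 1}` with `i` elements; a chain is the function of its
coordinates. -/
abbrev KoszulChain (R : Type u) [CommRing R] (r i : ℕ) : Type u := Subsets r i → R

/-- The Koszul differential of `x = x_0, …, x_{r-1}`:
`e_I ↦ ∑_{j ∈ I} (-1)^{#{k ∈ I : k < j}} x_j e_{I \ {j}}`, written in coordinates. -/
def koszulD (x : Fin r → R) (i : ℕ) : KoszulChain R r (i + 1) →ₗ[R] KoszulChain R r i where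
  toFun c J := ∑ j : {j : Fin r // j ∉ J.1}, (-1) ^ position J.1 j.1 * x j.1 * c (J.insert j)
  map_add' c c' := by
    funext J
    simp only [Pi.add_apply, mul_add, Finset.sum_add_distrib]
  map_smul' a c := by
    funext J
    simp only [Pi.smul_apply, smul_eq_mul, RingHom.id_apply, Finset.mul_sum]
    exact Finset.sum_congr rfl fun _ _ => by ring

/-- The Koszul homology `H_{i+1}(K_•(x))`; only positive degrees are needed. -/
abbrev KoszulHomologySucc (x : Fin r → R) (i : ℕ) : Type u :=
  Homology (koszulD x (i + 1)) (koszulD x i)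

/-- The coboundaries in degree `i` of the complex `Hom_R(K_•(x), M)`. -/
def koszulCoboundaries (x : Fin r → R) (M : Type v) [AddCommGroup M] [Module R M] :
    (i : ℕ) → Submodule R (KoszulChain R r i →ₗ[R] M)
  | 0 => ⊥
  | i + 1 => LinearMap.range (LinearMap.lcomp R M (koszulD x i))

/-- The cocycles in degree `i` of `Hom_R(K_•(x), M)`. -/
def koszulCocycles (x : Fin r → R) (M : Type v) [AddCommGroup M] [Module R M] (i : ℕ) :
    Submodule R (KoszulChain R r i →ₗ[R] M) :=
  LinearMap.ker (LinearMap.lcomp R M (koszulD x i))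

/-- The Koszul cohomology `H^i(Hom_R(K_•(x), M))`. -/
abbrev KoszulCohomology (x : Fin r → R) (M : Type v) [AddCommGroup M] [Module R M] (i : ℕ) :
    Type (max u v) :=
  koszulCocycles x M i ⧸ (koszulCoboundaries x M i).submoduleOf (koszulCocycles x M i)

/-- The Koszul grade of a finite sequence `x` on `M`: the infimum of all `i` such that
`H^i(Hom_R(K_•(x), M)) ≠ 0`. -/
def koszulGradeSeq (x : Fin r → R) (M : Type v) [AddCommGroup M] [Module R M] : ℕ∞ :=
  ⨅ (i : ℕ) (_ : Nontrivial (KoszulCohomology x M i)), (i : ℕ∞)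

/-- The Koszul grade of an ideal `a` on `M`: the supremum of the Koszul grades of the finitely
generated subideals of `a`, that is, of all finite sequences of elements of `a`. -/
def koszulGrade (a : Ideal R) (M : Type v) [AddCommGroup M] [Module R M] : ℕ∞ :=
  ⨆ (r : ℕ) (x : Fin r → R) (_ : ∀ k, x k ∈ a), koszulGradeSeq x M

/-- The map `K_i(x^m) → K_i(x^n)`, `e_I ↦ (∏_{k ∈ I} x_k)^{m-n} e_I`, for `n ≤ m`. -/
def koszulPowMap (x : Fin r → R) (m n i : ℕ) : KoszulChain R r i →ₗ[R] KoszulChain R r i where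
  toFun c I := (∏ k ∈ I.1, x k) ^ (m - n) * c I
  map_add' c c' := by
    funext I
    simp only [Pi.add_apply, mul_add]
  map_smul' a c := by
    funext I
    simp only [Pi.smul_apply, smul_eq_mul, RingHom.id_apply]
    ring

theorem koszulPowMap_comm (x : Fin r → R) {m n : ℕ} (h : n ≤ m) (i : ℕ) :
    koszulPowMap x m n i ∘ₗ koszulD (fun k => x k ^ m) i =
      koszulD (fun k => x k ^ n) i ∘ₗ koszulPowMap x m n (i + 1) := by
  refine LinearMap.ext fun c => ?_
  funext J
  simp only [LinearMap.comp_apply, koszulPowMap, koszulD, LinearMap.coe_mk, AddHom.coe_mk,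
    Finset.mul_sum]
  refine Finset.sum_congr rfl fun j _ => ?_
  have hp : ∏ k ∈ (J.insert j).1, x k = x j.1 * ∏ k ∈ J.1, x k := Finset.prod_insert j.2
  have hm : x j.1 ^ m = x j.1 ^ n * x j.1 ^ (m - n) := by rw [← pow_add, Nat.add_sub_cancel' h]
  rw [hp, hm, mul_pow]
  ring

/-- The sequence `x` is weakly proregular: for each `n > 0` there is `m ≥ n` such that the maps
`H_i(K_•(x^m)) → H_i(K_•(x^n))` are zero for all `i ≥ 1`. -/
def IsWeaklyProregular (x : Fin r → R) : Prop :=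
  ∀ n : ℕ, 0 < n → ∃ (m : ℕ) (h : n ≤ m), ∀ i : ℕ,
    (homologyMap (koszulPowMap x m n (i + 2)) (koszulPowMap x m n (i + 1)) (koszulPowMap x m n i)
        (koszulPowMap_comm x h (i + 1)) (koszulPowMap_comm x h i) :
      KoszulHomologySucc (fun k => x k ^ m) i →ₗ[R] KoszulHomologySucc (fun k => x k ^ n) i) = 0

end Koszul

/-! ### The Čech complex -/

section Cech

variable {R : Type u} [CommRing R] {r : ℕ}

/-- The localization of `R` at the product of the `x_k`, `k ∈ I`. -/
abbrev CechLoc (x : Fin r → R) (I : Finset (Fin r)) : Type u := Localization.Away (∏ k ∈ I, x k)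

/-- The module of Čech cochains of degree `i`. -/
abbrev CechCochain (x : Fin r → R) (i : ℕ) : Type u := (I : Subsets r i) → CechLoc x I.1

theorem cechLoc_isUnit (x : Fin r → R) {I J : Finset (Fin r)} (h : I ⊆ J)
    (y : Submonoid.powers (∏ k ∈ I, x k)) : IsUnit (algebraMap R (CechLoc x J) y) := by
  obtain ⟨_, n, rfl⟩ := y
  have hu : IsUnit (algebraMap R (CechLoc x J) (∏ k ∈ J, x k)) :=
    IsLocalization.Away.algebraMap_isUnit _
  have hd : (∏ k ∈ I, x k) ∣ ∏ k ∈ J, x k := Finset.prod_dvd_prod_of_subset _ _ _ h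
  simpa only [map_pow] using (isUnit_of_dvd_unit (map_dvd _ hd) hu).pow n

/-- The canonical map of `R`-algebras from the localization for `I` to that for `J ⊇ I`. -/
def cechRes (x : Fin r → R) {I J : Finset (Fin r)} (h : I ⊆ J) :
    CechLoc x I →ₐ[R] CechLoc x J :=
  IsLocalization.liftAlgHom (M := Submonoid.powers (∏ k ∈ I, x k))
    (f := Algebra.ofId R (CechLoc x J)) (cechLoc_isUnit x h)

/-- The Čech differential
`(d c)_J = ∑_{j ∈ J} (-1)^{#{k ∈ J : k < j}} c_{J \ {j}}`. -/
def cechD (x : Fin r → R) (i : ℕ) : CechCochain x i →ₗ[R] CechCochain x (i + 1) :=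
  LinearMap.pi fun J => ∑ j : {j : Fin r // j ∈ J.1},
    (-1 : R) ^ position J.1 j.1 •
      ((cechRes x (Finset.erase_subset j.1 J.1)).toLinearMap ∘ₗ
        (LinearMap.proj (J.erase j) : CechCochain x i →ₗ[R] CechLoc x (J.erase j).1))

/-- The Čech coboundaries of degree `i`. -/
def cechCoboundaries (x : Fin r → R) : (i : ℕ) → Submodule R (CechCochain x i)
  | 0 => ⊥
  | i + 1 => LinearMap.range (cechD x i)

/-- The Čech cohomology `H^i_x(R)`. -/
abbrev CechCohomology (x : Fin r → R) (i : ℕ) : Type u :=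
  LinearMap.ker (cechD x i) ⧸ (cechCoboundaries x i).submoduleOf (LinearMap.ker (cechD x i))

end Cech

/-! ### Parameter sequences and weakly associated primes -/

section Parameters

variable {R : Type u} [CommRing R]

/-- `x = x_0, …, x_{r-1}` is a parameter sequence on `R`: it is weakly proregular, `(x) ≠ R`, and
`H^r_x(R)_p ≠ 0` for all primes `p` containing `(x)`. -/
structure IsParameterSeq {r : ℕ} (x : Fin r → R) : Prop where
  weaklyProregular : IsWeaklyProregular x
  span_ne_top : Ideal.span (Set.range x) ≠ ⊤
  cech_nontrivial : ∀ (p : Ideal R) [p.IsPrime], Ideal.span (Set.range x) ≤ p →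
    Nontrivial (LocalizedModule p.primeCompl (CechCohomology x r))

/-- A strong parameter sequence: each initial segment of positive length is a parameter
sequence. -/
def IsStrongParameterSeq {r : ℕ} (x : Fin r → R) : Prop :=
  ∀ (i : ℕ) (h : i ≤ r), 1 ≤ i → IsParameterSeq (fun k : Fin i => x (Fin.castLE h k))

/-- The weakly associated primes of `M`: the primes that are minimal over `(0 :_R m)` for some
`m ∈ M`. -/
def weaklyAssociatedPrimes (R : Type u) [CommRing R] (M : Type v) [AddCommGroup M] [Module R M] :
    Set (Ideal R) :=
  {p | ∃ m : M, p ∈ (Ideal.torsionOf R M m).minimalPrimes}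

end Parameters

/-! ### Cohen-Macaulay rings -/

/-- The depth of a local ring: the supremum of the lengths of the regular sequences in the maximal
ideal. -/
def depth (A : Type u) [CommRing A] [IsLocalRing A] : ℕ∞ :=
  ⨆ (s : List A) (_ : ∀ a ∈ s, a ∈ IsLocalRing.maximalIdeal A)
    (_ : RingTheory.Sequence.IsRegular A s), (s.length : ℕ∞)

/-- The classical notion, meant for Noetherian rings: `depth R_m = dim R_m` for every maximal
ideal `m`. -/
def IsClassicalCM (R : Type u) [CommRing R] : Prop :=
  ∀ (m : Ideal R) [m.IsMaximal],
    (depth (Localization.AtPrime m) : WithBot ℕ∞) = ringKrullDim (Localization.AtPrime m)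

/-- Cohen-Macaulay in the sense of Hamilton-Marley: every strong parameter sequence (of positive
length) is a regular sequence. -/
def IsHamiltonMarleyCM (R : Type u) [CommRing R] : Prop :=
  ∀ (r : ℕ) (x : Fin r → R), 1 ≤ r → IsStrongParameterSeq x →
    RingTheory.Sequence.IsRegular R (List.ofFn x)

/-- Cohen-Macaulay in the sense of Glaz: `ht p = K.grade(p R_p, R_p)` for every prime `p`. -/
def IsGlazCM (R : Type u) [CommRing R] : Prop :=
  ∀ (p : Ideal R) [p.IsPrime],
    p.height = koszulGrade (p.map (algebraMap R (Localization.AtPrime p)))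
      (Localization.AtPrime p)

/-- Weak Bourbaki unmixed: `min(a) = wAss(R/a)` for every finitely generated ideal `a` whose
height is at least its minimal number of generators. -/
def IsWeakBourbakiUnmixed (R : Type u) [CommRing R] : Prop :=
  ∀ a : Ideal R, a.FG → (Submodule.spanFinrank a : ℕ∞) ≤ a.height →
    a.minimalPrimes = weaklyAssociatedPrimes R (R ⧸ a)

/-- Cohen-Macaulay in the sense of a class `𝒜` of ideals: `ht a = K.grade(a, R)` for all `a` in
`𝒜`. -/
def IsCMFor (R : Type u) [CommRing R] (𝒜 : Set (Ideal R)) : Prop :=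
  ∀ a ∈ 𝒜, a.height = koszulGrade a R

end

end NonNoethCM

/-
Call a ring unmixed if the weakly associated primes of an ideal generated by a weakly regular
sequence have height at most the length of the sequence. In an unmixed ring these are the minimal
primes of the ideal, and prime avoidance gives regular sequences of length `n` in every ideal of
height at least `n`. That yields `ht a ≤ K.grade(a)` and the unmixedness of ideals `a` with
`μ(a) ≤ ht a`. It also shows that strong parameter sequences are regular: if `x_{i+1}` were in a
minimal prime `P` of `(x_1, …, x_i)`, then `s x_{i+1}^c ∈ (x_1, …, x_i)` for some `s ∉ P`, so that a
power of `s` kills any given class of the top Čech cohomology of `x_1, …, x_{i+1}`, which would then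
vanish at `P`.

A Noetherian Cohen-Macaulay ring is unmixed, and unmixedness passes to polynomial rings in finitely
many variables. Any finite set of polynomials lives in finitely many variables, and adjoining the
remaining ones is faithfully flat and preserves primes; so unmixedness ascends to arbitrarily many
variables. A nonzero Koszul grade over a Noetherian ring is witnessed by a regular element, whence
flat descent to the Noetherian subrings gives `K.grade(a) ≤ ht a`. Faithful flatness over Noetherian
rings survives localization, so the same bound holds over `A_p`.
-/

namespace NonNoethCM

open RingTheory.Sequence

section Position

variable {r : ℕ} {J : Finset (Fin r)} {j k : Fin r}

theorem position_erase_of_lt (hk : k ∈ J) (h : k < j) :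
    position (J.erase k) j + 1 = position J j := by
  rw [position, Finset.filter_erase]
  exact Finset.card_erase_add_one (Finset.mem_filter.2 ⟨hk, h⟩)

theorem position_erase_of_not_lt (h : ¬ k < j) : position (J.erase k) j = position J j := by
  rw [position, Finset.filter_erase, Finset.erase_eq_of_notMem (by simp [h]), position]

theorem position_insert_of_lt (hk : k ∉ J) (h : k < j) :
    position (insert k J) j = position J j + 1 := by
  rw [← position_erase_of_lt (Finset.mem_insert_self k J) h, Finset.erase_insert hk]

theorem position_insert_of_not_lt (hk : k ∉ J) (h : ¬ k < j) :
    position (insert k J) j = position J j := by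
  rw [← position_erase_of_not_lt (J := insert k J) h, Finset.erase_insert hk]

end Position

section KoszulCochain

variable {A M N : Type*} [CommRing A] [AddCommGroup M] [Module A M] [AddCommGroup N] [Module A N]
  {r : ℕ} (y : Fin r → A)

/-- The differential of `Hom_A(K_•(y), M)`, written on coordinates. A cochain `c` has the
coordinate `c J` at `e_J`, and the coordinates of all degrees are carried along at once, so that a
cochain of degree `i` is only relevant on the `J` with `i` elements. -/
def koszulCochainD : (Finset (Fin r) → M) →ₗ[A] Finset (Fin r) → M :=
  LinearMap.pi fun J =>
    ∑ j ∈ J, ((-1 : A) ^ position J j * y j) • LinearMap.proj (J.erase j)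

theorem koszulCochainD_apply (c : Finset (Fin r) → M) (J : Finset (Fin r)) :
    koszulCochainD y c J = ∑ j ∈ J, ((-1 : A) ^ position J j * y j) • c (J.erase j) := by
  simp only [koszulCochainD, LinearMap.pi_apply, LinearMap.sum_apply, LinearMap.smul_apply,
    LinearMap.proj_apply]

variable {y} in
theorem koszulCochainD_congr {b c : Finset (Fin r) → M} {J : Finset (Fin r)}
    (h : ∀ K : Finset (Fin r), K.card + 1 = J.card → b K = c K) :
    koszulCochainD y b J = koszulCochainD y c J := by
  rw [koszulCochainD_apply, koszulCochainD_apply]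
  exact Finset.sum_congr rfl fun j hj => by rw [h _ (Finset.card_erase_add_one hj)]

theorem koszulCochainD_empty (c : Finset (Fin r) → M) : koszulCochainD y c ∅ = 0 := by
  rw [koszulCochainD_apply, Finset.sum_empty]

theorem koszulCochainD_comp (f : M →ₗ[A] N) (c : Finset (Fin r) → M) (J : Finset (Fin r)) :
    koszulCochainD y (f ∘ c) J = f (koszulCochainD y c J) := by
  simp only [koszulCochainD_apply, map_sum, map_smul, Function.comp_apply]

theorem koszulCochainD_algebraMap {B : Type*} [CommRing B] [Algebra A B] [Module B M]
    [IsScalarTower A B M] (c : Finset (Fin r) → M) :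
    koszulCochainD (fun j => algebraMap A B (y j)) c = koszulCochainD y c := by
  funext J
  rw [koszulCochainD_apply, koszulCochainD_apply]
  refine Finset.sum_congr rfl fun j _ => ?_
  rw [← algebraMap_smul B ((-1 : A) ^ position J j * y j), map_mul, map_pow, map_neg, map_one]

theorem koszulCochainD_koszulCochainD (c : Finset (Fin r) → M) :
    koszulCochainD y (koszulCochainD y c) = 0 := by
  funext J
  simp only [koszulCochainD_apply, Finset.smul_sum, smul_smul]
  rw [Finset.sum_sigma']
  refine Finset.sum_involution (fun p _ => ⟨p.2, p.1⟩) ?_ ?_ ?_ fun _ _ => rfl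
  · rintro ⟨j, k⟩ h
    simp only [Finset.mem_sigma, Finset.mem_erase] at h
    obtain ⟨hj, hkj, hk⟩ := h
    rw [Finset.erase_right_comm (a := k) (b := j), ← add_smul]
    convert zero_smul A _
    rcases lt_or_gt_of_ne hkj with hlt | hlt
    · rw [← position_erase_of_lt hk hlt, position_erase_of_not_lt (not_lt_of_gt hlt)]
      ring
    · rw [← position_erase_of_lt hj hlt, position_erase_of_not_lt (not_lt_of_gt hlt)]
      ring
  · rintro ⟨j, k⟩ h _ he
    simp only [Finset.mem_sigma, Finset.mem_erase] at h
    simp only [Sigma.mk.injEq, heq_eq_eq] at he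
    exact h.2.1 he.1
  · rintro ⟨j, k⟩ h
    simp only [Finset.mem_sigma, Finset.mem_erase] at h ⊢
    exact ⟨h.2.2, h.2.1.symm, h.1⟩

variable (A) in
/-- Contraction of a cochain with the basis element `e_j`. Its anticommutator with the differential
is multiplication by `y_j`, so it is a homotopy witnessing that `y_j` annihilates the Koszul
cohomology. -/
def contract (j : Fin r) (c : Finset (Fin r) → M) (J : Finset (Fin r)) : M :=
  if j ∈ J then 0 else (-1 : A) ^ position J j • c (insert j J)

theorem koszulCochainD_contract_of_mem {j : Fin r} {J : Finset (Fin r)} (hj : j ∈ J)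
    (c : Finset (Fin r) → M) : koszulCochainD y (contract A j c) J = y j • c J := by
  rw [koszulCochainD_apply, Finset.sum_eq_single_of_mem j hj]
  · rw [contract, if_neg (Finset.notMem_erase j J), position_erase_of_not_lt (lt_irrefl j),
      Finset.insert_erase hj, smul_smul, mul_right_comm, ← pow_add, (Even.add_self _).neg_one_pow,
      one_mul]
  · intro k _ hkj
    rw [contract, if_pos (Finset.mem_erase.2 ⟨hkj.symm, hj⟩), smul_zero]

theorem koszulCochainD_contract_add (j : Fin r) (c : Finset (Fin r) → M) (J : Finset (Fin r)) :
    koszulCochainD y (contract A j c) J + contract A j (koszulCochainD y c) J =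
      y j • c J := by
  by_cases hj : j ∈ J
  · rw [koszulCochainD_contract_of_mem y hj, contract, if_pos hj, add_zero]
  · have anticomm : ∀ k ∈ J, ((-1 : A) ^ position J k * y k) • contract A j c (J.erase k) +
        (-1 : A) ^ position J j •
          ((-1 : A) ^ position (insert j J) k * y k) • c ((insert j J).erase k) = 0 := by
      intro k hk
      have hkj : k ≠ j := fun h => hj (h ▸ hk)
      rw [contract, if_neg fun h => hj (Finset.mem_of_mem_erase h),
        Finset.erase_insert_of_ne hkj.symm, smul_smul, smul_smul, ← add_smul]
      convert zero_smul A _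
      rcases lt_or_gt_of_ne hkj with hlt | hlt
      · rw [← position_erase_of_lt hk hlt, position_insert_of_not_lt hj (not_lt_of_gt hlt)]
        ring
      · rw [position_erase_of_not_lt (not_lt_of_gt hlt), position_insert_of_lt hj hlt]
        ring
    rw [contract, if_neg hj, koszulCochainD_apply, koszulCochainD_apply, Finset.sum_insert hj,
      smul_add, Finset.smul_sum, add_left_comm, ← Finset.sum_add_distrib,
      Finset.sum_eq_zero anticomm, add_zero, Finset.erase_insert hj,
      position_insert_of_not_lt hj (lt_irrefl j), smul_smul, ← mul_assoc, ← pow_add,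
      (Even.add_self _).neg_one_pow, one_mul]

end KoszulCochain

section KoszulGrade

open scoped Pointwise

variable {A M N : Type*} [CommRing A] [AddCommGroup M] [Module A M] [AddCommGroup N] [Module A N]
  {r : ℕ} (y : Fin r → A)

variable (A) in
/-- The `A`-linear map `K_i → M` on Koszul chains whose coordinates are those of `c`. -/
noncomputable def cochainHom (i : ℕ) :
    (Finset (Fin r) → M) →ₗ[A] KoszulChain A r i →ₗ[A] M :=
  (LinearEquiv.piRing A M (Subsets r i) A).symm.toLinearMap ∘ₗ LinearMap.funLeft A M Subtype.val

theorem cochainHom_apply (i : ℕ) (c : Finset (Fin r) → M) (v : KoszulChain A r i) :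
    cochainHom A i c v = ∑ I : Subsets r i, v I • c I.1 :=
  LinearEquiv.piRing_symm_apply ..

theorem cochainHom_surjective (i : ℕ) : Function.Surjective (cochainHom A (M := M) (r := r) i) := by
  rw [cochainHom, LinearMap.coe_comp]
  exact (LinearEquiv.surjective _).comp
    (LinearMap.funLeft_surjective_of_injective A M _ Subtype.val_injective)

theorem cochainHom_eq_iff {i : ℕ} {b c : Finset (Fin r) → M} :
    cochainHom A i b = cochainHom A i c ↔ ∀ J : Finset (Fin r), J.card = i → b J = c J := by
  rw [cochainHom, LinearMap.comp_apply, LinearMap.comp_apply, LinearEquiv.coe_coe,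
    EmbeddingLike.apply_eq_iff_eq, funext_iff, Subtype.forall]
  rfl

/-- Adding `j ∉ J` to `J` against removing `j ∈ K` from `K`. -/
def subsetsInsertEquiv (r i : ℕ) :
    (Σ J : Subsets r i, {j : Fin r // j ∉ J.1}) ≃
      Σ K : Subsets r (i + 1), {j : Fin r // j ∈ K.1} where
  toFun p := ⟨p.1.insert p.2, p.2.1, Finset.mem_insert_self _ _⟩
  invFun p := ⟨p.1.erase p.2, p.2.1, Finset.notMem_erase _ _⟩
  left_inv := by
    rintro ⟨⟨J, hJ⟩, j, hj⟩
    exact Sigma.subtype_ext (Subtype.ext (Finset.erase_insert hj)) rfl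
  right_inv := by
    rintro ⟨⟨J, hJ⟩, j, hj⟩
    exact Sigma.subtype_ext (Subtype.ext (Finset.insert_erase hj)) rfl

theorem cochainHom_comp_koszulD (i : ℕ) (c : Finset (Fin r) → M) :
    cochainHom A i c ∘ₗ koszulD y i = cochainHom A (i + 1) (koszulCochainD y c) := by
  refine LinearMap.ext fun v => ?_
  have source : ∀ J : Subsets r i, koszulD y i v J • c J.1 = ∑ j : {j : Fin r // j ∉ J.1},
      ((-1) ^ position J.1 j.1 * y j.1 * v (J.insert j)) • c J.1 :=
    fun _ => by rw [← Finset.sum_smul]; rfl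
  have target : ∀ K : Subsets r (i + 1), v K • koszulCochainD y c K.1 =
      ∑ j : {j : Fin r // j ∈ K.1},
        v K • ((-1 : A) ^ position K.1 j.1 * y j.1) • c (K.1.erase j.1) := by
    intro K
    rw [koszulCochainD_apply, Finset.smul_sum, ← Finset.sum_coe_sort]
  rw [LinearMap.comp_apply, cochainHom_apply, cochainHom_apply,
    Finset.sum_congr rfl fun J _ => source J, Finset.sum_congr rfl fun K _ => target K,
    ← Fintype.sum_sigma', ← Fintype.sum_sigma']
  refine Fintype.sum_equiv (subsetsInsertEquiv r i) _ _ ?_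
  rintro ⟨⟨J, hJ⟩, j, hj : j ∉ J⟩
  change ((-1) ^ position J j * y j * v (Subsets.insert ⟨J, hJ⟩ ⟨j, hj⟩)) • c J =
    v (Subsets.insert ⟨J, hJ⟩ ⟨j, hj⟩) •
      ((-1 : A) ^ position (insert j J) j * y j) • c ((insert j J).erase j)
  rw [Finset.erase_insert hj, position_insert_of_not_lt hj (lt_irrefl j), smul_smul, mul_comm]

theorem cochainHom_mem_koszulCocycles {i : ℕ} {c : Finset (Fin r) → M} :
    cochainHom A i c ∈ koszulCocycles y M i ↔
      ∀ J, J.card = i + 1 → koszulCochainD y c J = 0 := by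
  rw [koszulCocycles, LinearMap.mem_ker, LinearMap.lcomp_apply', cochainHom_comp_koszulD,
    ← map_zero (cochainHom A (i + 1)), cochainHom_eq_iff]
  rfl

theorem cochainHom_mem_koszulCoboundaries {i : ℕ} {c : Finset (Fin r) → M} :
    cochainHom A i c ∈ koszulCoboundaries y M i ↔
      ∃ b : Finset (Fin r) → M, ∀ J, J.card = i → c J = koszulCochainD y b J := by
  cases i with
  | zero =>
    rw [koszulCoboundaries, Submodule.mem_bot, ← map_zero (cochainHom A 0), cochainHom_eq_iff]
    simp only [Finset.card_eq_zero, forall_eq, koszulCochainD_empty, exists_const, Pi.zero_apply]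
  | succ i =>
    rw [koszulCoboundaries, LinearMap.mem_range, (cochainHom_surjective i).exists]
    simp only [LinearMap.lcomp_apply', cochainHom_comp_koszulD, cochainHom_eq_iff, eq_comm]

theorem subsingleton_koszulCohomology_iff (i : ℕ) :
    Subsingleton (KoszulCohomology y M i) ↔ ∀ c : Finset (Fin r) → M,
      (∀ J, J.card = i + 1 → koszulCochainD y c J = 0) →
        ∃ b : Finset (Fin r) → M, ∀ J, J.card = i → c J = koszulCochainD y b J := by
  rw [Submodule.Quotient.subsingleton_iff, Submodule.submoduleOf_eq_top, SetLike.le_def,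
    (cochainHom_surjective i).forall]
  simp only [cochainHom_mem_koszulCocycles, cochainHom_mem_koszulCoboundaries]

theorem le_koszulGradeSeq_iff_subsingleton {n : ℕ} :
    (n : ℕ∞) ≤ koszulGradeSeq y M ↔ ∀ i < n, Subsingleton (KoszulCohomology y M i) := by
  simp only [koszulGradeSeq, le_iInf_iff, Nat.cast_le, ← not_nontrivial_iff_subsingleton]
  exact forall_congr' fun i => by rw [← not_le]; tauto

theorem le_koszulGradeSeq_iff {n : ℕ} :
    (n : ℕ∞) ≤ koszulGradeSeq y M ↔ ∀ c : Finset (Fin r) → M,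
      (∀ J, J.card ≤ n → koszulCochainD y c J = 0) →
        ∃ b : Finset (Fin r) → M, ∀ J, J.card < n → c J = koszulCochainD y b J := by
  simp only [le_koszulGradeSeq_iff_subsingleton, subsingleton_koszulCohomology_iff]
  constructor
  · intro h c hc
    have hex : ∀ i, ∃ b : Finset (Fin r) → M,
        i < n → ∀ J, J.card = i → c J = koszulCochainD y b J := by
      intro i
      by_cases hi : i < n
      · obtain ⟨b, hb⟩ := h i hi c fun J hJ => hc J (by omega)
        exact ⟨b, fun _ => hb⟩
      · exact ⟨0, fun h => absurd h hi⟩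
    choose b hb using hex
    refine ⟨fun K => b (K.card + 1) K, fun J hJ => ?_⟩
    rw [hb J.card hJ J rfl]
    exact koszulCochainD_congr fun K hK => by rw [hK]
  · intro h i hi c hc
    obtain ⟨b, hb⟩ := h (fun J => if J.card = i then c J else 0) fun J _ => by
      by_cases hJ : J.card = i + 1
      · rw [koszulCochainD_congr (c := c) fun K hK => if_pos (by omega), hc J hJ]
      · exact (koszulCochainD_congr (c := 0) fun K hK => if_neg (by omega)).trans
          (congrFun (map_zero _) J)
    exact ⟨b, fun J hJ => by rw [← hb J (by omega), if_pos hJ]⟩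

variable {y}

theorem koszulGradeSeq_algebraMap {B : Type*} [CommRing B] [Algebra A B] [Module B M]
    [IsScalarTower A B M] :
    koszulGradeSeq (fun j => algebraMap A B (y j)) M = koszulGradeSeq y M :=
  ENat.eq_of_forall_natCast_le_iff fun _ => by
    simp only [le_koszulGradeSeq_iff, koszulCochainD_algebraMap]

theorem koszulGradeSeq_le_of_linearEquiv (e : M ≃ₗ[A] N) :
    koszulGradeSeq y M ≤ koszulGradeSeq y N := by
  refine ENat.forall_natCast_le_iff_le.1 fun n hn => (le_koszulGradeSeq_iff y).2 fun c hc => ?_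
  obtain ⟨b, hb⟩ := (le_koszulGradeSeq_iff y).1 hn (e.symm.toLinearMap ∘ c) fun J hJ => by
    rw [koszulCochainD_comp, hc J hJ, map_zero]
  refine ⟨e.toLinearMap ∘ b, fun J hJ => ?_⟩
  rw [koszulCochainD_comp, ← hb J hJ]
  exact (e.apply_symm_apply _).symm

theorem eq_zero_of_forall_smul_eq_zero (h : 1 ≤ koszulGradeSeq y M) {m : M}
    (hm : ∀ j, y j • m = 0) : m = 0 := by
  obtain ⟨b, hb⟩ := (le_koszulGradeSeq_iff (n := 1) y).1 h (fun _ => m) fun J _ => by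
    rw [koszulCochainD_apply]
    exact Finset.sum_eq_zero fun j _ => by rw [mul_smul, hm, smul_zero]
  rw [hb ∅ Nat.zero_lt_one, koszulCochainD_empty]

variable (z : A)

theorem mkQ_smul_eq_zero (m : M) : (z • (⊤ : Submodule A M)).mkQ (z • m) = 0 :=
  (Submodule.Quotient.mk_eq_zero _).2 (Submodule.smul_mem_pointwise_smul _ z _ Submodule.mem_top)

theorem exists_mkQ_comp_eq {ι : Type*} (c : ι → QuotSMulTop z M) :
    ∃ c' : ι → M, (z • (⊤ : Submodule A M)).mkQ ∘ c' = c :=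
  ⟨_, funext fun J => Function.surjInv_eq (Submodule.mkQ_surjective _) (c J)⟩

variable {z}

theorem exists_smul_eq_of_mkQ_eq_zero {ι : Type*} {p : ι → Prop} {c : ι → M}
    (h : ∀ J, p J → (z • (⊤ : Submodule A M)).mkQ (c J) = 0) :
    ∃ e : ι → M, ∀ J, p J → z • e J = c J := by
  have hdiv : ∀ J, ∃ e, p J → z • e = c J := fun J => by
    by_cases hJ : p J
    · obtain ⟨e, -, he⟩ := (Submodule.mem_smul_pointwise_iff_exists _ _ _).1
        ((Submodule.Quotient.mk_eq_zero _).1 (h J hJ))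
      exact ⟨e, fun _ => he⟩
    · exact ⟨0, fun h => absurd h hJ⟩
  exact ⟨_, fun J => (hdiv J).choose_spec⟩

theorem koszulGradeSeq_le_quotSMulTop_add_one (hz : IsSMulRegular M z) :
    koszulGradeSeq y M ≤ koszulGradeSeq y (QuotSMulTop z M) + 1 := by
  refine ENat.forall_natCast_le_iff_le.1 fun n hn => ?_
  obtain - | n := n
  · exact zero_le
  push_cast
  gcongr
  refine (le_koszulGradeSeq_iff y).2 fun c hc => ?_
  obtain ⟨c, rfl⟩ := exists_mkQ_comp_eq z c
  simp only [koszulCochainD_comp] at hc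
  obtain ⟨e, he⟩ := exists_smul_eq_of_mkQ_eq_zero hc
  have cocycle : ∀ J : Finset (Fin r), J.card ≤ n + 1 → koszulCochainD y e J = 0 := fun J hJ =>
    hz.right_eq_zero_of_smul <| calc
      z • koszulCochainD y e J = koszulCochainD y (z • e) J := by rw [map_smul, Pi.smul_apply]
      _ = koszulCochainD y (koszulCochainD y c) J :=
        koszulCochainD_congr fun K hK => he K (by omega)
      _ = 0 := by rw [koszulCochainD_koszulCochainD, Pi.zero_apply]
  obtain ⟨f, hf⟩ := (le_koszulGradeSeq_iff y).1 hn e cocycle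
  obtain ⟨b, hb⟩ := (le_koszulGradeSeq_iff y).1 ((Nat.cast_le.2 n.le_succ).trans hn) (c - z • f)
    fun J hJ => by
      rw [map_sub, map_smul, Pi.sub_apply, Pi.smul_apply, ← hf J (by omega), he J hJ, sub_self]
  refine ⟨(z • (⊤ : Submodule A M)).mkQ ∘ b, fun J hJ => ?_⟩
  rw [koszulCochainD_comp, ← hb J hJ, Pi.sub_apply, map_sub, Pi.smul_apply, mkQ_smul_eq_zero,
    sub_zero, Function.comp_apply]

theorem exists_smul_eq_koszulCochainD (hzy : z ∈ Ideal.span (Set.range y)) {n : ℕ}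
    {c : Finset (Fin r) → M} (hc : ∀ J, J.card ≤ n + 1 → koszulCochainD y c J = 0) :
    ∃ b : Finset (Fin r) → M, ∀ J, J.card ≤ n → z • c J = koszulCochainD y b J := by
  obtain ⟨a, rfl⟩ := Ideal.mem_span_range_iff_exists_fun.1 hzy
  refine ⟨∑ j, a j • contract A j c, fun J hJ => ?_⟩
  rw [map_sum, Finset.sum_apply, Finset.sum_smul]
  refine Finset.sum_congr rfl fun j _ => ?_
  have hcontract : contract A j (koszulCochainD y c) J = 0 := by
    by_cases hj : j ∈ J
    · exact if_pos hj
    · rw [contract, if_neg hj, hc _ (by rw [Finset.card_insert_of_notMem hj]; omega), smul_zero]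
  rw [map_smul, Pi.smul_apply, mul_smul, ← koszulCochainD_contract_add, hcontract, add_zero]

theorem koszulGradeSeq_quotSMulTop_add_one_le (hz : IsSMulRegular M z)
    (hzy : z ∈ Ideal.span (Set.range y)) :
    koszulGradeSeq y (QuotSMulTop z M) + 1 ≤ koszulGradeSeq y M := by
  refine ENat.forall_natCast_le_iff_le.1 fun n hn => ?_
  obtain - | n := n
  · exact zero_le
  push_cast at hn
  replace hn : (n : ℕ∞) ≤ koszulGradeSeq y (QuotSMulTop z M) :=
    (ENat.add_le_add_iff_right ENat.one_ne_top).1 hn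
  refine (le_koszulGradeSeq_iff y).2 fun c hc => ?_
  obtain ⟨b, hb⟩ := exists_smul_eq_koszulCochainD hzy hc
  obtain ⟨g, hg⟩ := (le_koszulGradeSeq_iff y).1 hn ((z • (⊤ : Submodule A M)).mkQ ∘ b)
    fun J hJ => by rw [koszulCochainD_comp, ← hb J hJ, mkQ_smul_eq_zero]
  obtain ⟨g, rfl⟩ := exists_mkQ_comp_eq z g
  simp only [koszulCochainD_comp, Function.comp_apply] at hg
  obtain ⟨e, he⟩ := exists_smul_eq_of_mkQ_eq_zero (c := b - koszulCochainD y g)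
    fun J hJ => (map_sub _ _ _).trans (sub_eq_zero.2 (hg J hJ))
  refine ⟨e, fun J hJ => hz ?_⟩
  calc
    z • c J = koszulCochainD y (b - koszulCochainD y g) J := by
      rw [map_sub, koszulCochainD_koszulCochainD, sub_zero, hb J (by omega)]
    _ = koszulCochainD y (z • e) J :=
      koszulCochainD_congr fun K hK => (he K (by omega)).symm
    _ = z • koszulCochainD y e J := by rw [map_smul, Pi.smul_apply]

end KoszulGrade

section WeaklyRegular

variable {A M : Type*} [CommRing A] [AddCommGroup M] [Module A M] {r : ℕ} {y : Fin r → A}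
  {l : List A}

theorem length_le_koszulGradeSeq (hl : IsWeaklyRegular M l)
    (hly : Ideal.ofList l ≤ Ideal.span (Set.range y)) : (l.length : ℕ∞) ≤ koszulGradeSeq y M := by
  induction l generalizing M with
  | nil => exact zero_le
  | cons z l ih =>
    obtain ⟨hz, hl⟩ := (isWeaklyRegular_cons_iff M z l).1 hl
    rw [Ideal.ofList_cons, sup_le_iff, Ideal.span_singleton_le_iff_mem] at hly
    calc
      ((z :: l).length : ℕ∞) = l.length + 1 := by rw [List.length_cons, Nat.cast_succ]
      _ ≤ koszulGradeSeq y (QuotSMulTop z M) + 1 := by gcongr; exact ih hl hly.2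
      _ ≤ koszulGradeSeq y M := koszulGradeSeq_quotSMulTop_add_one_le hz hly.1

theorem koszulGradeSeq_le_add_length (hl : IsWeaklyRegular M l) :
    koszulGradeSeq y M ≤
      koszulGradeSeq y (M ⧸ Ideal.ofList l • (⊤ : Submodule A M)) + l.length := by
  induction l generalizing M with
  | nil =>
    have e : M ≃ₗ[A] M ⧸ Ideal.ofList ([] : List A) • (⊤ : Submodule A M) :=
      (Submodule.quotEquivOfEqBot _ (by rw [Ideal.ofList_nil, Submodule.bot_smul])).symm
    simpa using koszulGradeSeq_le_of_linearEquiv (y := y) e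
  | cons z l ih =>
    obtain ⟨hz, hl⟩ := (isWeaklyRegular_cons_iff M z l).1 hl
    have inner := koszulGradeSeq_le_of_linearEquiv (y := y)
      (Submodule.quotOfListConsSMulTopEquivQuotSMulTopInner M z l).symm
    calc
      koszulGradeSeq y M ≤ koszulGradeSeq y (QuotSMulTop z M) + 1 :=
        koszulGradeSeq_le_quotSMulTop_add_one hz
      _ ≤ koszulGradeSeq y (M ⧸ Ideal.ofList (z :: l) • (⊤ : Submodule A M)) + l.length + 1 := by
        gcongr
        exact (ih hl).trans (by gcongr)
      _ = _ := by rw [List.length_cons, Nat.cast_succ, add_assoc]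

theorem koszulGradeSeq_le_koszulGrade {a : Ideal A} (hy : ∀ j, y j ∈ a) :
    koszulGradeSeq y M ≤ koszulGrade a M :=
  le_iSup_of_le r (le_iSup₂_of_le y hy le_rfl)

theorem length_le_koszulGrade {a : Ideal A} (hl : IsWeaklyRegular M l) (hla : Ideal.ofList l ≤ a) :
    (l.length : ℕ∞) ≤ koszulGrade a M := by
  refine (length_le_koszulGradeSeq (y := l.get) hl ?_).trans
    (koszulGradeSeq_le_koszulGrade fun j => hla (Ideal.subset_span (List.get_mem l j)))
  rw [Set.range_list_get, Ideal.ofList]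

theorem isWeaklyRegular_concat_iff {z : A} :
    IsWeaklyRegular A (l ++ [z]) ↔
      IsWeaklyRegular A l ∧ IsSMulRegular (A ⧸ Ideal.ofList l) z := by
  rw [isWeaklyRegular_append_iff, isWeaklyRegular_singleton_iff]
  exact and_congr_right' <| LinearEquiv.isSMulRegular_congr
    (Submodule.quotEquivOfEq _ _ (by rw [smul_eq_mul, Ideal.mul_top])) z

theorem notMem_of_mem_minimalPrimes {I P : Ideal A} (hP : P ∈ I.minimalPrimes) {z : A}
    (hz : IsSMulRegular (A ⧸ I) z) : z ∉ P := fun hzP => by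
  obtain ⟨g, hg, hzg⟩ := Ideal.exists_mul_mem_of_mem_minimalPrimes hP hzP
  exact hg ((isSMulRegular_quotient_iff_mem_of_smul_mem I z).1 hz g hzg)

theorem length_le_height_of_isPrime (hl : IsWeaklyRegular A l) {P : Ideal A} [P.IsPrime]
    (hlP : Ideal.ofList l ≤ P) : (l.length : ℕ∞) ≤ P.height := by
  induction l using List.reverseRecOn generalizing P with
  | nil => exact zero_le
  | append_singleton l z ih =>
    obtain ⟨hl, hz⟩ := isWeaklyRegular_concat_iff.1 hl
    rw [Ideal.ofList_append, sup_le_iff, Ideal.ofList_singleton,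
      Ideal.span_singleton_le_iff_mem] at hlP
    obtain ⟨Q, hQ, hQP⟩ := Ideal.exists_minimalPrimes_le hlP.1
    have := hQ.isPrime
    have hlt : Q < P := lt_of_le_of_ne hQP fun h => notMem_of_mem_minimalPrimes hQ hz (h ▸ hlP.2)
    calc
      ((l ++ [z]).length : ℕ∞) = l.length + 1 := by
        rw [List.length_append, List.length_singleton, Nat.cast_succ]
      _ ≤ Q.height + 1 := by gcongr; exact ih hl hQ.le
      _ ≤ P.height := Ideal.height_add_one_le_of_lt_of_isPrime hlt

theorem length_le_height (hl : IsWeaklyRegular A l) {a : Ideal A} (hla : Ideal.ofList l ≤ a) :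
    (l.length : ℕ∞) ≤ a.height := by
  rw [Ideal.height_eq_inf_minimalPrimes]
  refine le_iInf₂ fun P hP => ?_
  have := hP.isPrime
  exact length_le_height_of_isPrime hl (hla.trans hP.le)

end WeaklyRegular

section FaithfullyFlat

open TensorProduct

variable {S : Type*} [CommRing S] {N : Type*} [AddCommGroup N] [Module S N]
  {A : Type*} [CommRing A] [Algebra S A] {r : ℕ} {y : Fin r → S}

theorem exists_ne_zero_forall_smul_eq_zero [IsNoetherianRing S] {P : Ideal S}
    (hP : P ∈ associatedPrimes S N) : ∃ g : N, g ≠ 0 ∧ ∀ z ∈ P, z • g = 0 := by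
  obtain ⟨hprime, g, rfl⟩ := isAssociatedPrime_iff.1 hP
  refine ⟨g, ?_, fun z hz => by rwa [Submodule.mem_colon_singleton, Submodule.mem_bot] at hz⟩
  rintro rfl
  exact hprime.ne_top (Ideal.eq_top_of_isUnit_mem _ (by simp) isUnit_one)

theorem exists_mem_isSMulRegular [IsNoetherianRing S] [Module.Finite S N] {a : Ideal S}
    (h : ∀ P ∈ associatedPrimes S N, ¬ a ≤ P) : ∃ z ∈ a, IsSMulRegular N z := by
  by_contra! hz
  have hcover : (a : Set S) ⊆ ⋃ P ∈ associatedPrimes S N, (id P : Ideal S) := fun z hza => by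
    rw [show ⋃ P ∈ associatedPrimes S N, ((id P : Ideal S) : Set S) = _ from
      biUnion_associatedPrimes_eq_compl_regular S N]
    exact hz z hza
  obtain ⟨P, hP, hle⟩ := (Ideal.subset_union_prime_finite (associatedPrimes.finite S N) ⊤ ⊤
    fun P hP _ _ => hP.isPrime).1 hcover
  exact h P hP hle

theorem isSMulRegular_of_tensor [Module.FaithfullyFlat S A] {z : S}
    (hz : IsSMulRegular (A ⊗[S] N) z) : IsSMulRegular N z :=
  hz.of_injective (TensorProduct.mk S A N 1) (Module.FaithfullyFlat.tensorProduct_mk_injective N)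

theorem isWeaklyRegular_of_tensor [Module.FaithfullyFlat S A] {l : List S}
    (hl : IsWeaklyRegular (A ⊗[S] N) l) : IsWeaklyRegular N l := by
  induction l generalizing N with
  | nil => exact IsWeaklyRegular.nil S N
  | cons z l ih =>
    rw [isWeaklyRegular_cons_iff] at hl ⊢
    exact ⟨isSMulRegular_of_tensor hl.1, ih <| (LinearEquiv.isWeaklyRegular_congr
      (QuotSMulTop.tensorQuotSMulTopEquivQuotSMulTop z A N) l).2 hl.2⟩

theorem isWeaklyRegular_map_algebraMap_iff_of_faithfullyFlat [Module.FaithfullyFlat S A]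
    {l : List S} : IsWeaklyRegular A (l.map (algebraMap S A)) ↔ IsWeaklyRegular S l :=
  ⟨fun h => isWeaklyRegular_of_tensor (A := A) <| (LinearEquiv.isWeaklyRegular_congr
    (TensorProduct.rid S A) l).2 ((isWeaklyRegular_map_algebraMap_iff A A l).1 h), .of_flat⟩

theorem exists_mem_span_isSMulRegular_of_one_le_koszulGradeSeq [IsNoetherianRing S]
    [Module.Finite S N] [Module.FaithfullyFlat S A] (h : 1 ≤ koszulGradeSeq y (A ⊗[S] N)) :
    ∃ z ∈ Ideal.span (Set.range y), IsSMulRegular N z := by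
  refine exists_mem_isSMulRegular fun P hP hle => ?_
  obtain ⟨g, hg, hPg⟩ := exists_ne_zero_forall_smul_eq_zero hP
  have htmul : (1 : A) ⊗ₜ[S] g = 0 := eq_zero_of_forall_smul_eq_zero h fun j => by
    rw [← tmul_smul, hPg _ (hle (Ideal.subset_span (Set.mem_range_self j))), tmul_zero]
  exact hg (Module.FaithfullyFlat.tensorProduct_mk_injective N (htmul.trans (tmul_zero _ _).symm))

theorem exists_isWeaklyRegular_of_le_koszulGradeSeq_tensor [IsNoetherianRing S]
    [Module.Finite S N] [Module.FaithfullyFlat S A] {n : ℕ}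
    (h : n ≤ koszulGradeSeq y (A ⊗[S] N)) :
    ∃ l, IsWeaklyRegular N l ∧ l.length = n ∧ Ideal.ofList l ≤ Ideal.span (Set.range y) := by
  induction n generalizing N with
  | zero => exact ⟨[], .nil S N, rfl, by rw [Ideal.ofList_nil]; exact bot_le⟩
  | succ n ih =>
    push_cast at h
    obtain ⟨z, hzy, hz⟩ :=
      exists_mem_span_isSMulRegular_of_one_le_koszulGradeSeq (le_add_self.trans h)
    have hquot : (n : ℕ∞) ≤ koszulGradeSeq y (A ⊗[S] QuotSMulTop z N) :=
      (ENat.add_le_add_iff_right ENat.one_ne_top).1 <| calc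
        (n : ℕ∞) + 1 ≤ koszulGradeSeq y (A ⊗[S] N) := h
        _ ≤ koszulGradeSeq y (QuotSMulTop z (A ⊗[S] N)) + 1 :=
          koszulGradeSeq_le_quotSMulTop_add_one (hz.lTensor A)
        _ ≤ koszulGradeSeq y (A ⊗[S] QuotSMulTop z N) + 1 := by
          gcongr
          exact koszulGradeSeq_le_of_linearEquiv
            (QuotSMulTop.tensorQuotSMulTopEquivQuotSMulTop z A N).symm
    obtain ⟨l, hl, hlen, hly⟩ := ih hquot
    refine ⟨z :: l, .cons hz hl, congrArg (· + 1) hlen, ?_⟩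
    rw [Ideal.ofList_cons]
    exact sup_le ((Ideal.span_singleton_le_iff_mem _).2 hzy) hly

theorem koszulGradeSeq_algebraMap_le_height [IsNoetherianRing S] [Module.FaithfullyFlat S A]
    {a : Ideal A} (hy : ∀ j, algebraMap S A (y j) ∈ a) :
    koszulGradeSeq (fun j => algebraMap S A (y j)) A ≤ a.height := by
  refine ENat.forall_natCast_le_iff_le.1 fun n hn => ?_
  rw [koszulGradeSeq_algebraMap] at hn
  obtain ⟨l, hl, rfl, hly⟩ := exists_isWeaklyRegular_of_le_koszulGradeSeq_tensor (N := S) <|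
    hn.trans (koszulGradeSeq_le_of_linearEquiv (TensorProduct.rid S A).symm)
  have hla : Ideal.ofList (l.map (algebraMap S A)) ≤ a := by
    rw [← Ideal.map_ofList, Ideal.map_le_iff_le_comap]
    exact hly.trans (Ideal.span_le.2 (Set.range_subset_iff.2 hy))
  rw [← List.length_map (algebraMap S A)]
  exact length_le_height hl.of_flat hla

end FaithfullyFlat

section WeaklyAssociatedPrimes

variable {A M : Type*} [CommRing A] [AddCommGroup M] [Module A M] {I P : Ideal A}

theorem isPrime_of_mem_weaklyAssociatedPrimes (hP : P ∈ weaklyAssociatedPrimes A M) :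
    P.IsPrime :=
  let ⟨_, hm⟩ := hP
  hm.isPrime

theorem exists_mem_weaklyAssociatedPrimes_of_not_isSMulRegular {z : A}
    (hz : ¬ IsSMulRegular M z) : ∃ P ∈ weaklyAssociatedPrimes A M, z ∈ P := by
  rw [isSMulRegular_iff_right_eq_zero_of_smul] at hz
  push Not at hz
  obtain ⟨m, hzm, hm⟩ := hz
  obtain ⟨P, hP⟩ := Ideal.nonempty_minimalPrimes (I := Ideal.torsionOf A M m)
    fun h => hm ((Ideal.torsionOf_eq_top_iff A m).1 h)
  exact ⟨P, ⟨m, hP⟩, hP.le hzm⟩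

theorem mem_weaklyAssociatedPrimes_quotient_iff :
    P ∈ weaklyAssociatedPrimes A (A ⧸ I) ↔ ∃ g : A, P ∈ (I.colon {g}).minimalPrimes := by
  refine Ideal.Quotient.mk_surjective.exists.trans (exists_congr fun g => ?_)
  have htorsion : Ideal.torsionOf A (A ⧸ I) (Ideal.Quotient.mk I g) = I.colon {g} := by
    ext s
    rw [Ideal.mem_torsionOf_iff, Submodule.mem_colon_singleton, ← Ideal.Quotient.eq_zero_iff_mem]
    rfl
  rw [htorsion]

theorem le_of_mem_weaklyAssociatedPrimes (hP : P ∈ weaklyAssociatedPrimes A (A ⧸ I)) : I ≤ P :=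
  let ⟨g, hg⟩ := mem_weaklyAssociatedPrimes_quotient_iff.1 hP
  fun _ ht => hg.le (Submodule.mem_colon_singleton.2 (I.mul_mem_right g ht))

variable (I) in
theorem minimalPrimes_subset_weaklyAssociatedPrimes :
    I.minimalPrimes ⊆ weaklyAssociatedPrimes A (A ⧸ I) := fun P hP =>
  mem_weaklyAssociatedPrimes_quotient_iff.2 ⟨1, by
    have h : I.colon {1} = I := by
      ext t
      rw [Submodule.mem_colon_singleton, smul_eq_mul, mul_one]
    rwa [h]⟩

end WeaklyAssociatedPrimes

section PrimeAvoidance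

variable {A : Type*} [CommRing A]

theorem exists_add_notMem {T : Set (Ideal A)} (hT : T.Finite) (hprime : ∀ P ∈ T, P.IsPrime)
    (hanti : IsAntichain (· ≤ ·) T) {x : A} {I : Ideal A}
    (h : ∀ P ∈ T, ¬ Ideal.span {x} ⊔ I ≤ P) : ∃ w ∈ I, ∀ P ∈ T, x + w ∉ P := by
  classical
  let T₀ : Finset (Ideal A) := hT.toFinset.filter fun P => x ∉ P
  have hmem : ∀ P, P ∈ T₀ ↔ P ∈ T ∧ x ∉ P := fun P => by
    rw [Finset.mem_filter, hT.mem_toFinset]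
  -- `w` is chosen in all the primes not containing `x`, and outside all those containing `x`.
  have hsub : ¬ ((I * ∏ P ∈ T₀, P : Ideal A) : Set A) ⊆ ⋃ P ∈ {P ∈ T | x ∈ P}, (P : Set A) := by
    intro hsub
    obtain ⟨P, ⟨hP, hxP⟩, hle⟩ := (Ideal.subset_union_prime_finite (f := id)
      (hT.subset (Set.sep_subset T fun P => x ∈ P)) ⊤ ⊤ fun P hP _ _ => hprime P hP.1).1 hsub
    have hPprime := hprime P hP
    rcases hPprime.mul_le.1 hle with hIP | hprod
    · exact h P hP (sup_le ((Ideal.span_singleton_le_iff_mem _).2 hxP) hIP)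
    · obtain ⟨Q, hQ, hQP⟩ := hPprime.prod_le.1 hprod
      obtain ⟨hQT, hxQ⟩ := (hmem Q).1 hQ
      exact hxQ (hanti.eq hQT hP hQP ▸ hxP)
  obtain ⟨w, hw, hwT⟩ := Set.not_subset.1 hsub
  refine ⟨w, Ideal.mul_le_left hw, fun P hP hxw => ?_⟩
  by_cases hxP : x ∈ P
  · exact hwT (Set.mem_biUnion ⟨hP, hxP⟩ ((Ideal.add_mem_iff_right P hxP).1 hxw))
  · have hwP : w ∈ P := (Ideal.mul_le_right.trans (Ideal.prod_le_inf.trans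
      (Finset.inf_le ((hmem P).2 ⟨hP, hxP⟩)))) hw
    exact hxP ((Ideal.add_mem_iff_left P hwP).1 hxw)

end PrimeAvoidance

/-- The conclusion of Macaulay's unmixedness theorem, for the ideals generated by weakly regular
sequences: the heights of the weakly associated primes of such an ideal do not exceed the length of
the sequence. That it has only finitely many minimal primes, as in a Noetherian ring, is made part
of the notion to allow for prime avoidance. -/
structure IsUnmixed (A : Type*) [CommRing A] : Prop where
  finite_minimalPrimes {l : List A} : IsWeaklyRegular A l → (Ideal.ofList l).minimalPrimes.Finite
  height_le {l : List A} : IsWeaklyRegular A l →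
    ∀ P ∈ weaklyAssociatedPrimes A (A ⧸ Ideal.ofList l), P.height ≤ l.length

section Unmixed

variable {A : Type*} [CommRing A] {k l : List A} {a : Ideal A}

theorem span_singleton_add_sup_eq {x w : A} (hw : w ∈ a) :
    Ideal.span {x + w} ⊔ a = Ideal.span {x} ⊔ a := by
  refine le_antisymm (sup_le ?_ le_sup_right) (sup_le ?_ le_sup_right) <;>
    rw [Ideal.span_singleton_le_iff_mem]
  · exact Ideal.add_mem _ (Ideal.mem_sup_left (Ideal.mem_span_singleton_self x))
      (Ideal.mem_sup_right hw)
  · rw [← Ideal.add_mem_iff_left _ (Ideal.mem_sup_right hw)]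
    exact Ideal.mem_sup_left (Ideal.mem_span_singleton_self (x + w))

theorem IsUnmixed.weaklyAssociatedPrimes_eq (hA : IsUnmixed A) (hl : IsWeaklyRegular A l) :
    weaklyAssociatedPrimes A (A ⧸ Ideal.ofList l) = (Ideal.ofList l).minimalPrimes := by
  refine Set.Subset.antisymm (fun P hP => ?_) (minimalPrimes_subset_weaklyAssociatedPrimes _)
  have := isPrime_of_mem_weaklyAssociatedPrimes hP
  have hlP := le_of_mem_weaklyAssociatedPrimes hP
  have hfin : P.FiniteHeight := ⟨.inr ((hA.height_le hl P hP).trans_lt (ENat.natCast_lt_top _)).ne⟩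
  refine ⟨⟨this, hlP⟩, fun Q ⟨hQ, hlQ⟩ hQP => (eq_of_le_of_not_lt hQP fun hlt => ?_).ge⟩
  have := (Ideal.height_strict_mono_of_isPrime_of_isPrime hlt).trans_le (hA.height_le hl P hP)
  exact this.not_ge (length_le_height hl hlQ)

theorem IsUnmixed.isSMulRegular (hA : IsUnmixed A) (hl : IsWeaklyRegular A l) {z : A}
    (hz : ∀ P ∈ (Ideal.ofList l).minimalPrimes, z ∉ P) :
    IsSMulRegular (A ⧸ Ideal.ofList l) z := by
  by_contra hreg
  obtain ⟨P, hP, hzP⟩ := exists_mem_weaklyAssociatedPrimes_of_not_isSMulRegular hreg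
  exact hz P (hA.weaklyAssociatedPrimes_eq hl ▸ hP) hzP

theorem IsUnmixed.exists_isWeaklyRegular_concat (hA : IsUnmixed A) (hl : IsWeaklyRegular A l)
    {x : A} {I : Ideal A} (h : (l.length : ℕ∞) < (Ideal.ofList l ⊔ (Ideal.span {x} ⊔ I)).height) :
    ∃ w ∈ I, IsWeaklyRegular A (l ++ [x + w]) := by
  have hmin := hA.weaklyAssociatedPrimes_eq hl
  obtain ⟨w, hw, hwT⟩ := exists_add_notMem (T := (Ideal.ofList l).minimalPrimes)
    (hA.finite_minimalPrimes hl) (fun P hP => hP.isPrime)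
    (fun P hP Q hQ hne hle => hne (le_antisymm hle (hQ.2 hP.1 hle))) (x := x) (I := I)
    fun P hP hle =>
      ((Ideal.height_mono (sup_le hP.le hle)).trans (hA.height_le hl P (hmin ▸ hP))).not_gt h
  exact ⟨w, hw, isWeaklyRegular_concat_iff.2 ⟨hl, hA.isSMulRegular hl hwT⟩⟩

theorem IsUnmixed.exists_isWeaklyRegular (hA : IsUnmixed A) {n : ℕ} (hn : (n : ℕ∞) ≤ a.height) :
    ∃ l, IsWeaklyRegular A l ∧ l.length = n ∧ Ideal.ofList l ≤ a := by
  induction n with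
  | zero => exact ⟨[], .nil A A, rfl, by rw [Ideal.ofList_nil]; exact bot_le⟩
  | succ n ih =>
    rw [Nat.cast_succ] at hn
    obtain ⟨l, hl, rfl, hla⟩ := ih (le_self_add.trans hn)
    obtain ⟨w, hw, hlw⟩ := hA.exists_isWeaklyRegular_concat hl (x := 0) (I := a) <|
      (ENat.lt_add_one_iff (ENat.natCast_ne_top _)).2 le_rfl |>.trans_le <|
        hn.trans (Ideal.height_mono (le_sup_right.trans le_sup_right))
    refine ⟨l ++ [0 + w], hlw, by rw [List.length_append, List.length_singleton], ?_⟩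
    rw [Ideal.ofList_append, Ideal.ofList_singleton, zero_add]
    exact sup_le hla ((Ideal.span_singleton_le_iff_mem _).2 hw)

theorem IsUnmixed.height_le_koszulGrade (hA : IsUnmixed A) (a : Ideal A) :
    a.height ≤ koszulGrade a A := by
  refine ENat.forall_natCast_le_iff_le.1 fun n hn => ?_
  obtain ⟨l, hl, rfl, hla⟩ := hA.exists_isWeaklyRegular hn
  exact length_le_koszulGrade hl hla

theorem IsUnmixed.exists_isWeaklyRegular_ofList_eq (hA : IsUnmixed A) (hk : IsWeaklyRegular A k)
    (h : ((k ++ l).length : ℕ∞) ≤ (Ideal.ofList (k ++ l)).height) :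
    ∃ l', IsWeaklyRegular A l' ∧ l'.length = (k ++ l).length ∧
      Ideal.ofList l' = Ideal.ofList (k ++ l) := by
  induction l generalizing k with
  | nil => exact ⟨k, hk, by rw [List.append_nil], by rw [List.append_nil]⟩
  | cons x l ih =>
    have hlt : (k.length : ℕ∞) < (Ideal.ofList (k ++ x :: l)).height :=
      lt_of_lt_of_le (by rw [List.length_append, List.length_cons]; norm_cast; omega) h
    rw [Ideal.ofList_append, Ideal.ofList_cons] at hlt
    obtain ⟨w, hw, hkw⟩ := hA.exists_isWeaklyRegular_concat hk hlt
    have hlen : (k ++ [x + w] ++ l).length = (k ++ x :: l).length := by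
      simp only [List.length_append, List.length_cons, List.length_nil]
      omega
    have hspan : Ideal.ofList (k ++ [x + w] ++ l) = Ideal.ofList (k ++ x :: l) := by
      rw [Ideal.ofList_append, Ideal.ofList_append, Ideal.ofList_append, Ideal.ofList_singleton,
        Ideal.ofList_cons, sup_assoc, span_singleton_add_sup_eq hw]
    rw [← hlen, ← hspan] at h ⊢
    exact ih hkw h

theorem IsUnmixed.isWeakBourbakiUnmixed (hA : IsUnmixed A) : IsWeakBourbakiUnmixed A := by
  intro a ha hht
  obtain ⟨s, hs, hsa⟩ := Submodule.FG.exists_span_finset_card_eq_spanFinrank ha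
  have hofList : Ideal.ofList s.toList = a := by
    rw [← hsa, Ideal.ofList]
    simp only [Finset.mem_toList, Finset.setOfPred_mem, Ideal.submodule_span_eq]
  obtain ⟨l, hl, -, rfl⟩ : ∃ l, IsWeaklyRegular A l ∧ l.length = ([] ++ s.toList).length ∧
      Ideal.ofList l = a := by
    rw [← hofList]
    refine hA.exists_isWeaklyRegular_ofList_eq (.nil A A) ?_
    rwa [List.nil_append, Finset.length_toList, hs, hofList]
  exact (hA.weaklyAssociatedPrimes_eq hl).symm

end Unmixed

section Flat

variable {S A : Type*} [CommRing S] [CommRing A] [Algebra S A]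

theorem colon_map_algebraMap [Module.Flat S A] (I : Ideal S) (g : S) :
    (I.map (algebraMap S A)).colon {algebraMap S A g} = (I.colon {g}).map (algebraMap S A) := by
  refine le_antisymm (fun t ht => ?_) (Ideal.map_le_iff_le_comap.2 fun s hs => ?_)
  · rw [Submodule.mem_colon_singleton, smul_eq_mul] at ht
    obtain ⟨n, c, b, hsum⟩ := Submodule.mem_span_set'.1 ht
    choose x hx hxb using fun i => (b i).2
    obtain ⟨k, d, z, hz, hd⟩ := Module.Flat.isTrivialRelation_of_sum_smul_eq_zero
      (f := fun i : Option (Fin n) => i.elim g x) (x := fun i => i.elim t fun i => -c i) (by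
        simp only [Fintype.sum_option, Option.elim_none, Option.elim_some, Algebra.smul_def, hxb,
          mul_neg, Finset.sum_neg_distrib]
        rw [mul_comm, ← hsum, ← sub_eq_add_neg, sub_eq_zero]
        exact Finset.sum_congr rfl fun i _ => mul_comm _ _)
    rw [show t = ∑ j, d none j • z j from hz none]
    refine Ideal.sum_mem _ fun j _ => ?_
    rw [Algebra.smul_def]
    refine Ideal.mul_mem_right _ _ (Ideal.mem_map_of_mem _ (Submodule.mem_colon_singleton.2 ?_))
    have hdj : g * d none j + ∑ i, x i * d (some i) j = 0 :=
      (Fintype.sum_option _).symm.trans (hd j)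
    rw [smul_eq_mul, mul_comm, eq_neg_of_add_eq_zero_left hdj]
    exact neg_mem (Ideal.sum_mem _ fun i _ => Ideal.mul_mem_right _ _ (hx i))
  · rw [Submodule.mem_colon_singleton, smul_eq_mul] at hs
    rw [Ideal.mem_comap, Submodule.mem_colon_singleton, smul_eq_mul, ← map_mul]
    exact Ideal.mem_map_of_mem _ hs

end Flat

section Noetherian

open Pointwise

variable {S : Type*} [CommRing S] [IsNoetherianRing S]

theorem weaklyAssociatedPrimes_eq_associatedPrimes (M : Type*) [AddCommGroup M] [Module S M] :
    weaklyAssociatedPrimes S M = associatedPrimes S M := by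
  have htorsion (m : M) : Ideal.torsionOf S M m = (⊥ : Submodule S M).colon {m} := by
    ext s
    rw [Ideal.mem_torsionOf_iff, Submodule.mem_colon_singleton, Submodule.mem_bot]
  ext P
  refine ⟨fun ⟨m, hP⟩ => ?_, fun hP => ?_⟩
  · rw [htorsion] at hP
    exact isAssociatedPrime_iff.2 ⟨hP.isPrime, Submodule.exists_eq_colon_of_mem_minimalPrimes hP⟩
  · obtain ⟨hprime, m, rfl⟩ := isAssociatedPrime_iff.1 hP
    exact ⟨m, by rw [htorsion, Ideal.minimalPrimes_eq_subsingleton_self, Set.mem_singleton_iff]⟩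

theorem map_mem_associatedPrimes_of_isLocalization {B : Type*} [CommRing B] [Algebra S B]
    (T : Submonoid S) [IsLocalization T B] {I P : Ideal S}
    (hP : P ∈ associatedPrimes S (S ⧸ I)) (hdisj : Disjoint (T : Set S) P) :
    P.map (algebraMap S B) ∈ associatedPrimes B (B ⧸ I.map (algebraMap S B)) := by
  have := IsLocalization.flat B T
  have := IsLocalization.isNoetherianRing T B ‹_›
  have := hP.isPrime
  have := IsLocalization.isPrime_of_isPrime_disjoint T B P ‹_› hdisj
  rw [← weaklyAssociatedPrimes_eq_associatedPrimes, mem_weaklyAssociatedPrimes_quotient_iff] at hP ⊢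
  obtain ⟨g, hg⟩ := hP
  obtain ⟨x, rfl⟩ := Submodule.exists_eq_colon_of_mem_minimalPrimes hg
  refine ⟨algebraMap S B x, ?_⟩
  rw [colon_map_algebraMap, Ideal.minimalPrimes_eq_subsingleton_self, Set.mem_singleton_iff]

variable {M : Type*} [AddCommGroup M] [Module S M] [Module.Finite S M]

theorem exists_lt_mem_associatedPrimes_quotSMulTop {z : S} (hz : IsSMulRegular M z)
    (hzJ : z ∈ (⊥ : Ideal S).jacobson) {Q : Ideal S} (hQ : Q ∈ associatedPrimes S M) :
    ∃ Q' ∈ associatedPrimes S (QuotSMulTop z M), Q < Q' := by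
  obtain ⟨g, hg0, hQg⟩ := exists_ne_zero_forall_smul_eq_zero hQ
  let N := Submodule.torsionBySet S M Q
  have hmemN {m : M} : m ∈ N ↔ ∀ q ∈ Q, q • m = 0 := by
    rw [Submodule.mem_torsionBySet_iff]
    exact Subtype.forall
  obtain ⟨m, hmN, hm⟩ : ∃ m ∈ N, m ∉ z • (⊤ : Submodule S M) := by
    -- Otherwise `N = zN`, and `N = 0` by Nakayama's lemma.
    by_contra! hle
    refine hg0 ((Submodule.mem_bot S).1 (Submodule.le_of_le_smul_of_le_jacobson_bot
      (I := Ideal.span {z}) (IsNoetherian.noetherian N)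
      ((Ideal.span_singleton_le_iff_mem _).2 hzJ) (fun m hm => ?_) (hmemN.2 hQg)))
    obtain ⟨m, -, rfl⟩ := hle m hm
    rw [bot_sup_eq]
    refine Submodule.smul_mem_smul (Ideal.mem_span_singleton_self z) (hmemN.2 fun q hq => ?_)
    exact hz.right_eq_zero_of_smul (by rw [smul_comm]; exact hmemN.1 hm q hq)
  obtain ⟨Q', hQ', hle⟩ := exists_le_isAssociatedPrime_of_isNoetherianRing S
    (Submodule.Quotient.mk m : QuotSMulTop z M) ((Submodule.Quotient.mk_eq_zero _).not.2 hm)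
  have hkill {s : S} (hs : s • m ∈ z • (⊤ : Submodule S M)) : s ∈ Q' := hle <| by
    rw [Submodule.mem_colon_singleton, Submodule.mem_bot, ← Submodule.Quotient.mk_smul]
    exact (Submodule.Quotient.mk_eq_zero _).2 hs
  have hQQ' : Q ≤ Q' := fun q hq => hkill (by rw [hmemN.1 hmN q hq]; exact zero_mem _)
  refine ⟨Q', hQ', lt_of_le_not_ge hQQ' fun hQ'Q => hg0 (hz.right_eq_zero_of_smul ?_)⟩
  exact hQg z (hQ'Q (hkill (Submodule.smul_mem_pointwise_smul m z ⊤ Submodule.mem_top)))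

variable {r : ℕ} {y : Fin r → S}

theorem exists_mem_span_isSMulRegular (h : 1 ≤ koszulGradeSeq y M) :
    ∃ z ∈ Ideal.span (Set.range y), IsSMulRegular M z :=
  exists_mem_isSMulRegular fun _ hP hle =>
    let ⟨_, hg0, hg⟩ := exists_ne_zero_forall_smul_eq_zero hP
    hg0 (eq_zero_of_forall_smul_eq_zero h fun j => hg _ (hle (Ideal.subset_span ⟨j, rfl⟩)))

section IsLocalRing

variable [IsLocalRing S]

theorem height_add_koszulGradeSeq_le
    (hy : Ideal.span (Set.range y) = IsLocalRing.maximalIdeal S) {Q : Ideal S}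
    (hQ : Q ∈ associatedPrimes S M) :
    Q.height + koszulGradeSeq y M ≤ (IsLocalRing.maximalIdeal S).height := by
  suffices h : ∀ n : ℕ, n ≤ koszulGradeSeq y M →
      Q.height + n ≤ (IsLocalRing.maximalIdeal S).height by
    induction hg : koszulGradeSeq y M with
    | top =>
      rw [add_top, top_le_iff, ENat.eq_top_iff_forall_ge]
      exact fun n => le_add_self.trans (h n (hg ▸ le_top))
    | coe n => exact h n hg.ge
  intro n hn
  induction n generalizing M Q with
  | zero =>
    rw [Nat.cast_zero, add_zero]
    exact Ideal.height_mono (IsLocalRing.le_maximalIdeal hQ.isPrime.ne_top)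
  | succ n ih =>
    rw [Nat.cast_succ] at hn ⊢
    obtain ⟨z, hzy, hz⟩ := exists_mem_span_isSMulRegular (le_add_self.trans hn)
    obtain ⟨Q', hQ', hlt⟩ := exists_lt_mem_associatedPrimes_quotSMulTop hz
      (IsLocalRing.jacobson_eq_maximalIdeal (⊥ : Ideal S) bot_ne_top ▸ hy ▸ hzy) hQ
    have := hQ.isPrime
    have := hQ'.isPrime
    calc Q.height + (n + 1) = Q.height + 1 + n := by ring
      _ ≤ Q'.height + n := by gcongr; exact Ideal.height_add_one_le_of_lt_of_isPrime hlt
      _ ≤ _ := ih hQ' ((ENat.add_le_add_iff_right ENat.one_ne_top).1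
        (hn.trans (koszulGradeSeq_le_quotSMulTop_add_one hz)))

theorem height_le_length_of_mem_associatedPrimes
    (hy : Ideal.span (Set.range y) = IsLocalRing.maximalIdeal S)
    (hdepth : (IsLocalRing.maximalIdeal S).height ≤ koszulGradeSeq y S) {l : List S}
    (hl : IsWeaklyRegular S l) {Q : Ideal S} (hQ : Q ∈ associatedPrimes S (S ⧸ Ideal.ofList l)) :
    Q.height ≤ l.length := by
  have hgrade : koszulGradeSeq y S ≤ koszulGradeSeq y (S ⧸ Ideal.ofList l) + l.length := by
    have := koszulGradeSeq_le_add_length (y := y) hl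
    rwa [smul_eq_mul, Ideal.mul_top] at this
  have hle := height_add_koszulGradeSeq_le hy hQ
  have hne : koszulGradeSeq y (S ⧸ Ideal.ofList l) ≠ ⊤ := fun h => by
    rw [h, add_top, top_le_iff] at hle
    exact Ideal.height_ne_top (IsLocalRing.maximalIdeal.isMaximal S).ne_top hle
  refine (ENat.add_le_add_iff_right hne).1 ?_
  rw [add_comm (l.length : ℕ∞)]
  exact hle.trans (hdepth.trans hgrade)

end IsLocalRing

end Noetherian

section Depth

variable {S : Type*} [CommRing S]

theorem depth_le_koszulGradeSeq [IsLocalRing S] {r : ℕ} {y : Fin r → S}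
    (hy : Ideal.span (Set.range y) = IsLocalRing.maximalIdeal S) :
    depth S ≤ koszulGradeSeq y S :=
  iSup_le fun _ => iSup₂_le fun hl hreg =>
    length_le_koszulGradeSeq hreg.toIsWeaklyRegular ((Ideal.span_le.2 hl).trans hy.ge)

theorem length_le_depth_localization {l : List S} (hl : IsWeaklyRegular S l) {P : Ideal S}
    [P.IsPrime] (hlP : Ideal.ofList l ≤ P) :
    (l.length : ℕ∞) ≤ depth (Localization.AtPrime P) := by
  have hreg := hl.isRegular_of_isLocalization_of_mem (Localization.AtPrime P) P
    fun z hz => hlP (Ideal.subset_span hz)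
  refine le_iSup_of_le (l.map (algebraMap S (Localization.AtPrime P))) <|
    le_iSup₂_of_le (fun w hw => ?_) hreg (by rw [List.length_map])
  obtain ⟨z, hz, rfl⟩ := List.mem_map.1 hw
  exact (IsLocalization.AtPrime.to_map_mem_maximal_iff (Localization.AtPrime P) P z).2
    (hlP (Ideal.subset_span hz))

theorem isUnmixed_of_height_le_depth [IsNoetherianRing S]
    (h : ∀ (m : Ideal S) [m.IsMaximal], m.height ≤ depth (Localization.AtPrime m)) :
    IsUnmixed S where
  finite_minimalPrimes _ := Ideal.finite_minimalPrimes_of_isNoetherianRing S _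
  height_le {l} hl P hP := by
    rw [weaklyAssociatedPrimes_eq_associatedPrimes] at hP
    have := hP.isPrime
    obtain ⟨m, hm, hPm⟩ := Ideal.exists_le_maximal P hP.isPrime.ne_top
    let B := Localization.AtPrime m
    have hdisj : Disjoint (m.primeCompl : Set S) P :=
      Set.disjoint_left.2 fun s hs hsP => hs (hPm hsP)
    have hPB := map_mem_associatedPrimes_of_isLocalization (B := B) m.primeCompl hP hdisj
    obtain ⟨r, y, hy⟩ := Submodule.fg_iff_exists_fin_generating_family.1
      (IsNoetherian.noetherian (IsLocalRing.maximalIdeal B))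
    have hdepth : (IsLocalRing.maximalIdeal B).height ≤ koszulGradeSeq y B := by
      rw [← IsLocalization.height_under m.primeCompl, IsLocalization.AtPrime.under_maximalIdeal B m]
      exact (h m).trans (depth_le_koszulGradeSeq hy)
    rw [Ideal.map_ofList] at hPB
    rw [← IsLocalization.height_map_of_disjoint (S := B) m.primeCompl P hdisj,
      ← List.length_map (algebraMap S B)]
    exact height_le_length_of_mem_associatedPrimes hy hdepth hl.of_flat hPB

theorem IsClassicalCM.isUnmixed [IsNoetherianRing S] (hS : IsClassicalCM S) : IsUnmixed S :=
  isUnmixed_of_height_le_depth fun m _ => by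
    have h := hS m
    rw [IsLocalization.AtPrime.ringKrullDim_eq_height m] at h
    exact (WithBot.coe_injective h).ge

end Depth

section Polynomial

variable {S : Type*} [CommRing S]

open Polynomial

/-- McCoy's theorem for the polynomial ring over `S ⧸ I`. -/
theorem exists_notMem_mul_coeff_mem {I : Ideal S} {f : S[X]}
    (hf : ¬ IsSMulRegular (S[X] ⧸ I.map C) f) : ∃ s ∉ I, ∀ n, f.coeff n * s ∈ I := by
  have hmap (g : S[X]) : g ∈ I.map C ↔ g.map (Ideal.Quotient.mk I) = 0 := by
    rw [← coe_mapRingHom, ← RingHom.mem_ker, ker_mapRingHom, Ideal.mk_ker]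
  rw [isSMulRegular_iff_right_eq_zero_of_smul, Ideal.Quotient.mk_surjective.forall] at hf
  push Not at hf
  obtain ⟨g, hfg, hg⟩ := hf
  have hfg' : f * g ∈ I.map C := Ideal.Quotient.eq_zero_iff_mem.1 hfg
  rw [Ne, Ideal.Quotient.eq_zero_iff_mem, hmap] at hg
  rw [hmap, Polynomial.map_mul] at hfg'
  obtain ⟨a, ha, haf⟩ := Polynomial.notMem_nonZeroDivisors_iff.1 fun h => hg (h.1 _ hfg')
  obtain ⟨s, rfl⟩ := Ideal.Quotient.mk_surjective a
  refine ⟨s, fun hs => ha (Ideal.Quotient.eq_zero_iff_mem.2 hs), fun n => ?_⟩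
  have hcoeff := congrArg (coeff · n) haf
  rw [coeff_smul, coeff_map, coeff_zero, smul_eq_mul, ← map_mul, mul_comm] at hcoeff
  exact Ideal.Quotient.eq_zero_iff_mem.1 hcoeff

theorem not_isMaximal_map_C (Q : Ideal S) : ¬ (Q.map C).IsMaximal := fun h => by
  have hfield := (Ideal.Quotient.maximal_ideal_iff_isField_quotient _).1 h
  exact not_isField _ <|
    (Ideal.polynomialQuotientEquivQuotientPolynomial Q).toMulEquiv.isField hfield

theorem exists_mem_isSMulRegular_quotient_map_C [IsNoetherianRing S] (I : Ideal S) (P : Ideal S[X])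
    [hP : P.IsMaximal] : ∃ f ∈ P, IsSMulRegular (S[X] ⧸ I.map C) f := by
  by_contra! hreg
  have hsub : (P : Set S[X]) ⊆
      ⋃ Q ∈ associatedPrimes S (S ⧸ I), (Q.map C : Ideal S[X]) := fun f hf => by
    obtain ⟨s, hs, hsf⟩ := exists_notMem_mul_coeff_mem (hreg f hf)
    obtain ⟨Q, hQ, hle⟩ := exists_le_isAssociatedPrime_of_isNoetherianRing S
      (Ideal.Quotient.mk I s) (mt Ideal.Quotient.eq_zero_iff_mem.1 hs)
    refine Set.mem_biUnion hQ (Ideal.mem_map_C_iff.2 fun n => hle ?_)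
    rw [Submodule.mem_colon_singleton, Submodule.mem_bot]
    exact Ideal.Quotient.eq_zero_iff_mem.2 (hsf n)
  have hprime : ∀ Q ∈ associatedPrimes S (S ⧸ I), (Q.map C : Ideal S[X]).IsPrime := fun Q hQ =>
    have := hQ.isPrime
    inferInstance
  obtain ⟨Q, hQ, hle⟩ := (Ideal.subset_union_prime_finite (associatedPrimes.finite S (S ⧸ I)) ⊤ ⊤
    fun Q hQ _ _ => hprime Q hQ).1 hsub
  exact not_isMaximal_map_C Q (hP.eq_of_le (hprime Q hQ).ne_top hle ▸ hP)

theorem IsUnmixed.polynomial [IsNoetherianRing S] (hS : IsUnmixed S) : IsUnmixed S[X] := by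
  refine isUnmixed_of_height_le_depth fun P _ => ?_
  let p : Ideal S := P.under S
  have hlies : P.LiesOver p := ⟨rfl⟩
  obtain ⟨n, hn⟩ := ENat.ne_top_iff_exists.1 (Ideal.height_ne_top_of_isPrime (I := p))
  obtain ⟨l, hl, rfl, hlp⟩ := hS.exists_isWeaklyRegular hn.le
  obtain ⟨f, hfP, hf⟩ := exists_mem_isSMulRegular_quotient_map_C (Ideal.ofList l) P
  rw [Ideal.map_ofList] at hf
  have hlf : IsWeaklyRegular S[X] (l.map C ++ [f]) :=
    isWeaklyRegular_concat_iff.2 ⟨hl.of_flat, hf⟩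
  have hle : Ideal.ofList (l.map C ++ [f]) ≤ P := by
    rw [Ideal.ofList_append, Ideal.ofList_singleton, ← Ideal.map_ofList]
    exact sup_le (Ideal.map_le_iff_le_comap.2 hlp) ((Ideal.span_singleton_le_iff_mem _).2 hfP)
  have hlen := length_le_depth_localization hlf hle
  rwa [List.length_append, List.length_map, List.length_singleton, Nat.cast_add, Nat.cast_one, hn,
    ← Polynomial.height_eq_height_add_one p P] at hlen

end Polynomial

section Approximation

universe u v

variable {S : Type v} {A : Type u} [CommRing S] [CommRing A]

/-- `A` behaves over `S` like a polynomial ring: it is faithfully flat and prime ideals of `S`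
extend to prime ideals of `A`. -/
structure IsPolynomialLike (S A : Type*) [CommRing S] [CommRing A] [Algebra S A] : Prop where
  faithfullyFlat : Module.FaithfullyFlat S A
  isPrime_map (Q : Ideal S) [Q.IsPrime] : (Q.map (algebraMap S A)).IsPrime

theorem IsPolynomialLike.minimalPrimes_map_subset [Algebra S A] (hA : IsPolynomialLike S A)
    (I : Ideal S) :
    (I.map (algebraMap S A)).minimalPrimes ⊆ Ideal.map (algebraMap S A) '' I.minimalPrimes := by
  intro P hP
  have := hP.isPrime
  obtain ⟨Q, hQ, hQP⟩ := Ideal.exists_minimalPrimes_le (Ideal.map_le_iff_le_comap.1 hP.le)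
  have := hQ.isPrime
  have hle : Q.map (algebraMap S A) ≤ P := Ideal.map_le_iff_le_comap.2 hQP
  exact ⟨Q, hQ, hle.antisymm (hP.2 ⟨hA.isPrime_map Q, Ideal.map_mono hQ.le⟩ hle)⟩

theorem exists_finset_le_height_under {P : Ideal A} [P.IsPrime] {n : ℕ}
    (h : (n : ℕ∞) ≤ P.height) :
    ∃ F : Finset A, ∀ (S : Type v) [CommRing S] [Algebra S A],
      (F : Set A) ⊆ Set.range (algebraMap S A) → (n : ℕ∞) ≤ (P.under S).height := by
  classical
  induction n generalizing P with
  | zero => exact ⟨∅, fun S _ _ _ => zero_le⟩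
  | succ n ih =>
    obtain ⟨Q, hQ, hQP, hn⟩ : ∃ Q : Ideal A, Q.IsPrime ∧ Q < P ∧ (n : ℕ∞) ≤ Q.height := by
      by_contra! hcon
      exact (h.trans (Ideal.height_le_iff.2 hcon)).not_gt (by exact_mod_cast n.lt_succ_self)
    obtain ⟨F, hF⟩ := ih hn
    obtain ⟨z, hzP, hzQ⟩ := SetLike.exists_of_lt hQP
    refine ⟨insert z F, fun S _ _ hS => ?_⟩
    rw [Finset.coe_insert, Set.insert_subset_iff] at hS
    obtain ⟨⟨w, rfl⟩, hFS⟩ := hS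
    have hlt : Q.under S < P.under S :=
      SetLike.lt_iff_le_and_exists.2 ⟨Ideal.comap_mono hQP.le, w, hzP, hzQ⟩
    calc ((n + 1 : ℕ) : ℕ∞) ≤ (Q.under S).height + 1 := by
          push_cast
          gcongr
          exact hF S hFS
      _ ≤ (P.under S).height := Ideal.height_add_one_le_of_lt_of_isPrime hlt

theorem IsUnmixed.of_approximations
    (h : ∀ F : Finset A, ∃ (S : Type v) (_ : CommRing S) (_ : Algebra S A),
      IsUnmixed S ∧ IsPolynomialLike S A ∧ (F : Set A) ⊆ Set.range (algebraMap S A)) :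
    IsUnmixed A where
  finite_minimalPrimes {l} hl := by
    classical
    obtain ⟨S, _, _, hS, hSA, hF⟩ := h l.toFinset
    have := hSA.faithfullyFlat
    obtain ⟨l, rfl⟩ : l ∈ Set.range (List.map (algebraMap S A)) := by
      rw [Set.range_list_map]
      exact fun z hz => hF (List.mem_toFinset.2 hz)
    rw [← Ideal.map_ofList]
    exact ((hS.finite_minimalPrimes <|
      isWeaklyRegular_map_algebraMap_iff_of_faithfullyFlat.1 hl).image _).subset
        (hSA.minimalPrimes_map_subset _)
  height_le {l} hl P hP := by
    classical
    have := isPrime_of_mem_weaklyAssociatedPrimes hP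
    obtain ⟨g, hg⟩ := mem_weaklyAssociatedPrimes_quotient_iff.1 hP
    refine ENat.forall_natCast_le_iff_le.1 fun n hn => ?_
    obtain ⟨F, hF⟩ := exists_finset_le_height_under hn
    obtain ⟨S, _, _, hS, hSA, hFS⟩ := h (insert g (l.toFinset ∪ F))
    have := hSA.faithfullyFlat
    rw [Finset.coe_insert, Finset.coe_union, Set.insert_subset_iff, Set.union_subset_iff] at hFS
    obtain ⟨⟨g, rfl⟩, hlS, hFS⟩ := hFS
    obtain ⟨l, rfl⟩ : l ∈ Set.range (List.map (algebraMap S A)) := by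
      rw [Set.range_list_map]
      exact fun z hz => hlS (List.mem_toFinset.2 hz)
    rw [← Ideal.map_ofList, colon_map_algebraMap] at hg
    obtain ⟨Q, hQ, rfl⟩ := hSA.minimalPrimes_map_subset _ hg
    calc (n : ℕ∞) ≤ ((Q.map (algebraMap S A)).under S).height := hF S hFS
      _ = Q.height := by
        rw [Ideal.under, Ideal.comap_map_eq_self_of_faithfullyFlat]
      _ ≤ l.length := hS.height_le
        (isWeaklyRegular_map_algebraMap_iff_of_faithfullyFlat.1 hl) Q
        (mem_weaklyAssociatedPrimes_quotient_iff.2 ⟨g, hQ⟩)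
      _ = (l.map (algebraMap S A)).length := by rw [List.length_map]

theorem IsUnmixed.of_ringEquiv (hS : IsUnmixed S) (e : S ≃+* A) : IsUnmixed A := by
  refine .of_approximations fun _ => ⟨S, inferInstance, e.toRingHom.toAlgebra, hS, ?_, ?_⟩
  · let := e.toRingHom.toAlgebra
    let e' : A ≃ₗ[S] S := (LinearEquiv.ofBijective (Algebra.linearMap S A) e.bijective).symm
    exact ⟨.of_linearEquiv S S e', fun Q _ => Ideal.map_isPrime_of_equiv e⟩
  · exact fun z _ => ⟨e.symm z, e.apply_symm_apply z⟩

/-- Every finite subset of `A` comes from a Noetherian ring over which `A` is faithfully flat. -/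
def IsNoetherianApproximable (A : Type u) [CommRing A] : Prop :=
  ∀ F : Finset A, ∃ (S : Type u) (_ : CommRing S) (_ : Algebra S A),
    IsNoetherianRing S ∧ Module.FaithfullyFlat S A ∧ (F : Set A) ⊆ Set.range (algebraMap S A)

theorem IsNoetherianApproximable.koszulGrade_le_height (hA : IsNoetherianApproximable A)
    (a : Ideal A) : koszulGrade a A ≤ a.height := by
  classical
  refine iSup_le fun r => iSup₂_le fun y hy => ?_
  obtain ⟨S, _, _, _, _, hF⟩ := hA (Finset.univ.image y)
  obtain ⟨w, rfl⟩ : ∃ w : Fin r → S, (fun j => algebraMap S A (w j)) = y := by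
    choose w hw using fun j => hF (Finset.mem_coe.2 (Finset.mem_image_of_mem y (Finset.mem_univ j)))
    exact ⟨w, funext hw⟩
  exact koszulGradeSeq_algebraMap_le_height hy

theorem IsNoetherianApproximable.localization_atPrime (hA : IsNoetherianApproximable A)
    (P : Ideal A) [P.IsPrime] : IsNoetherianApproximable (Localization.AtPrime P) := by
  classical
  intro F
  choose num den hmk using
    IsLocalization.exists_mk'_eq P.primeCompl (S := Localization.AtPrime P)
  obtain ⟨S, _, _, _, _, hF⟩ := hA (F.image num ∪ F.image fun z => (den z : A))
  let := Localization.AtPrime.algebraOfLiesOver (P.under S) P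
  have : IsLocalHom
      (algebraMap (Localization.AtPrime (P.under S)) (Localization.AtPrime P)) :=
    Localization.isLocalHom_localRingHom (P.under S) P (algebraMap S A) rfl
  have : Module.FaithfullyFlat (Localization.AtPrime (P.under S)) (Localization.AtPrime P) :=
    .of_flat_of_isLocalHom
  refine ⟨Localization.AtPrime (P.under S), inferInstance, inferInstance, inferInstance,
    inferInstance, fun z hz => ?_⟩
  obtain ⟨s, hs⟩ := hF (Finset.mem_union_left _ (Finset.mem_image_of_mem num hz))
  obtain ⟨t, ht⟩ := hF (Finset.mem_union_right _ (Finset.mem_image_of_mem _ hz))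
  have htP : t ∉ P.under S := fun h => (den z).2 (by rwa [Ideal.mem_comap, ht] at h)
  refine ⟨IsLocalization.mk' _ s (⟨t, htP⟩ : (P.under S).primeCompl), ?_⟩
  change Localization.localRingHom (P.under S) P (algebraMap S A) rfl _ = z
  rw [Localization.localRingHom_mk', ← hmk z]
  exact congrArg₂ _ hs (Subtype.ext ht)

end Approximation

section MvPolynomial

universe u v

variable {σ : Type u} {R : Type v} [CommRing R]

theorem IsPolynomialLike.of_algEquiv {S A B : Type*} [CommRing S] [CommRing A] [CommRing B]
    [Algebra S A] [Algebra S B] (hA : IsPolynomialLike S A) (e : A ≃ₐ[S] B) :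
    IsPolynomialLike S B where
  faithfullyFlat :=
    have := hA.faithfullyFlat
    .of_linearEquiv S A e.symm.toLinearEquiv
  isPrime_map Q _ := by
    have := hA.isPrime_map Q
    rw [← e.toAlgHom.comp_algebraMap, ← Ideal.map_map]
    exact Ideal.map_isPrime_of_equiv e

theorem isPolynomialLike_mvPolynomial (S τ : Type*) [CommRing S] :
    IsPolynomialLike S (MvPolynomial τ S) where
  faithfullyFlat := .of_linearEquiv S _ (MvPolynomial.basisMonomials τ S).repr
  isPrime_map Q _ := by
    rw [← Ideal.Quotient.isDomain_iff_prime]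
    exact (MvPolynomial.quotientEquivQuotientMvPolynomial (σ := τ) Q).symm.toMulEquiv.isDomain

theorem isPolynomialLike_supported (s : Set σ) :
    IsPolynomialLike (MvPolynomial.supported R s) (MvPolynomial σ R) := by
  classical
  let e₁ := MvPolynomial.supportedEquivMvPolynomial (R := R) s
  let e₂ : MvPolynomial ↥sᶜ (MvPolynomial s R) ≃ₐ[R] MvPolynomial σ R :=
    (MvPolynomial.sumAlgEquiv R ↥sᶜ s).symm.trans
      (MvPolynomial.renameEquiv R ((Equiv.sumComm _ _).trans (Equiv.Set.sumCompl s)))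
  have he₂ (p : MvPolynomial s R) : e₂ (MvPolynomial.C p) = MvPolynomial.rename (↑) p := by
    have : e₂.toAlgHom.comp (IsScalarTower.toAlgHom R (MvPolynomial s R) _) =
        MvPolynomial.rename (↑) := by
      ext i
      simp [e₂, MvPolynomial.algebraMap_eq]
    exact DFunLike.congr_fun this p
  let e : MvPolynomial ↥sᶜ (MvPolynomial.supported R s) ≃+* MvPolynomial σ R :=
    (MvPolynomial.mapEquiv _ e₁.toRingEquiv).trans e₂.toRingEquiv
  refine (isPolynomialLike_mvPolynomial _ ↥sᶜ).of_algEquiv (.ofRingEquiv (f := e) fun p => ?_)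
  obtain ⟨p, rfl⟩ := e₁.symm.surjective p
  calc e (MvPolynomial.C (e₁.symm p)) = MvPolynomial.rename (↑) p := by
        simp [e, he₂]
    _ = algebraMap _ _ (e₁.symm p) := rfl

theorem exists_finite_subset_range_algebraMap_supported (F : Finset (MvPolynomial σ R)) :
    ∃ s : Set σ, s.Finite ∧ (F : Set (MvPolynomial σ R)) ⊆
      Set.range (algebraMap (MvPolynomial.supported R s) (MvPolynomial σ R)) := by
  classical
  refine ⟨F.biUnion MvPolynomial.vars, Finset.finite_toSet _, fun f hf => ⟨⟨f, ?_⟩, rfl⟩⟩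
  exact MvPolynomial.mem_supported.2 <| Finset.coe_subset.2 <| Finset.subset_biUnion_of_mem _ hf

variable [IsNoetherianRing R]

variable (σ R) in
theorem isNoetherianApproximable_mvPolynomial :
    IsNoetherianApproximable (MvPolynomial σ R) := by
  intro F
  obtain ⟨s, hs, hF⟩ := exists_finite_subset_range_algebraMap_supported F
  have := hs.to_subtype
  exact ⟨MvPolynomial.supported R s, inferInstance, inferInstance,
    isNoetherianRing_of_ringEquiv _ (MvPolynomial.supportedEquivMvPolynomial s).symm.toRingEquiv,
    (isPolynomialLike_supported s).faithfullyFlat, hF⟩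

theorem IsUnmixed.mvPolynomial_of_finite (hR : IsUnmixed R) [Finite σ] :
    IsUnmixed (MvPolynomial σ R) := by
  induction σ using Finite.induction_empty_option with
  | of_equiv e h => exact h.of_ringEquiv (MvPolynomial.renameEquiv R e).toRingEquiv
  | h_empty => exact hR.of_ringEquiv (MvPolynomial.isEmptyRingEquiv R PEmpty).symm
  | h_option h =>
    exact h.polynomial.of_ringEquiv (MvPolynomial.optionEquivLeft R _).symm.toRingEquiv

variable (σ) in
theorem IsUnmixed.mvPolynomial (hR : IsUnmixed R) : IsUnmixed (MvPolynomial σ R) := by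
  refine .of_approximations fun F => ?_
  obtain ⟨s, hs, hF⟩ := exists_finite_subset_range_algebraMap_supported F
  have := hs.to_subtype
  exact ⟨MvPolynomial.supported R s, inferInstance, inferInstance,
    hR.mvPolynomial_of_finite.of_ringEquiv
      (MvPolynomial.supportedEquivMvPolynomial s).symm.toRingEquiv,
    isPolynomialLike_supported s, hF⟩

end MvPolynomial

section Cech

variable {A : Type*} [CommRing A] {r i : ℕ}

theorem Subsets.eq_univ (J : Subsets r r) : J.1 = Finset.univ :=
  (Finset.card_eq_iff_eq_univ J.1).1 (by rw [J.2, Fintype.card_fin])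

theorem Subsets.erase_subset (J : Subsets r (i + 1)) (j : {j : Fin r // j ∈ J.1}) :
    (J.erase j).1 ⊆ J.1 :=
  Finset.erase_subset j.1 J.1

theorem Subsets.erase_injective (J : Subsets r (i + 1)) : Function.Injective J.erase :=
  fun j _ h => Subtype.ext ((Finset.erase_inj J.1 j.2).1 (congrArg Subtype.val h))

theorem cechD_apply (x : Fin r → A) (b : CechCochain x i) (J : Subsets r (i + 1)) :
    cechD x i b J = ∑ j : {j : Fin r // j ∈ J.1},
      (-1 : A) ^ position J.1 j.1 • cechRes x (J.erase_subset j) (b (J.erase j)) := by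
  rw [cechD, LinearMap.pi_apply, LinearMap.sum_apply]
  rfl

theorem cechD_single (x : Fin r → A) (J : Subsets r (i + 1)) (j : {j : Fin r // j ∈ J.1})
    (v : CechLoc x (J.erase j).1) :
    cechD x i (Pi.single (J.erase j) ((-1 : A) ^ position J.1 j.1 • v)) J =
      cechRes x (J.erase_subset j) v := by
  rw [cechD_apply, Finset.sum_eq_single_of_mem j (Finset.mem_univ j)]
  · rw [Pi.single_eq_same, map_smul, smul_smul, ← mul_pow, neg_one_mul, neg_neg, one_pow, one_smul]
  · intro k _ hkj
    rw [Pi.single_eq_of_ne (J.erase_injective.ne hkj), map_zero, smul_zero]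

theorem isUnit_algebraMap_cechLoc (x : Fin r → A) {I : Finset (Fin r)} {k : Fin r} (hk : k ∈ I)
    (n m : ℕ) : IsUnit (algebraMap A (CechLoc x I) ((∏ j ∈ I, x j) ^ n * x k ^ m)) := by
  have hprod : IsUnit (algebraMap A (CechLoc x I) (∏ j ∈ I, x j)) :=
    IsLocalization.Away.algebraMap_isUnit _
  rw [map_mul, map_pow, map_pow]
  exact (hprod.pow n).mul <|
    (isUnit_of_dvd_unit (map_dvd _ (Finset.dvd_prod_of_mem x hk)) hprod).pow m

theorem exists_mul_cechD_eq (x : Fin r → A) (J : Subsets r (i + 1)) {j k : Fin r} (hj : j ∈ J.1)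
    (hk : k ∈ J.1) (hkj : k ≠ j) (a : A) (n m : ℕ) :
    ∃ b : CechCochain x i, algebraMap A (CechLoc x J.1) ((∏ l ∈ J.1, x l) ^ n * x k ^ m) *
      cechD x i b J = algebraMap A _ (a * x j ^ n) := by
  let I := J.erase ⟨j, hj⟩
  let hIJ : I.1 ⊆ J.1 := J.erase_subset ⟨j, hj⟩
  obtain ⟨c, hc⟩ :=
    (isUnit_algebraMap_cechLoc x (I := I.1) (Finset.mem_erase.2 ⟨hkj, hk⟩) n m).exists_right_inv
  have hprod : (∏ l ∈ J.1, x l) ^ n * x k ^ m =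
      x j ^ n * ((∏ l ∈ I.1, x l) ^ n * x k ^ m) := by
    rw [← mul_assoc, ← mul_pow]
    exact congrArg (· ^ n * x k ^ m) (Finset.mul_prod_erase J.1 x hj).symm
  refine ⟨Pi.single I ((-1 : A) ^ position J.1 j • (algebraMap A _ a * c)), ?_⟩
  rw [cechD_single x J ⟨j, hj⟩, hprod, map_mul, mul_assoc, ← (cechRes x hIJ).commutes (_ * _),
    ← map_mul, mul_left_comm, hc, mul_one, AlgHom.commutes, ← map_mul, mul_comm]

theorem exists_pow_mul_pow_mem_span_pow {y : Fin r → A} {s z : A} {c : ℕ}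
    (h : s * z ^ c ∈ Ideal.span (Set.range y)) (n : ℕ) :
    ∃ N m : ℕ, s ^ N * z ^ m ∈ Ideal.span (Set.range fun j => y j ^ n) := by
  obtain ⟨N, hN⟩ := Ideal.exists_pow_le_of_le_radical_of_fg
    (I := Ideal.span (Set.range y)) (J := Ideal.span (Set.range fun j => y j ^ n))
    (Ideal.span_le.2 <| Set.range_subset_iff.2 fun j => ⟨n, Ideal.subset_span ⟨j, rfl⟩⟩)
    (Submodule.fg_span (Set.finite_range _))
  refine ⟨N, c * N, ?_⟩
  rw [pow_mul, ← mul_pow]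
  exact hN (Ideal.pow_mem_pow h N)

theorem smul_mem_range_cechD {x : Fin (r + 1) → A} {t : A} {n m : ℕ}
    (ht : t * x (Fin.last r) ^ m ∈ Ideal.span (Set.range fun j : Fin r => x j.castSucc ^ n))
    {w : CechCochain x (r + 1)} {a : A} (J : Subsets (r + 1) (r + 1))
    (hw : w J * algebraMap A (CechLoc x J.1) ((∏ k ∈ J.1, x k) ^ n) = algebraMap A _ a) :
    t • w ∈ LinearMap.range (cechD x r) := by
  have hJ (k : Fin (r + 1)) : k ∈ J.1 := J.eq_univ ▸ Finset.mem_univ k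
  obtain ⟨c, hc⟩ := Ideal.mem_span_range_iff_exists_fun.1 ht
  choose b hb using fun j : Fin r => exists_mul_cechD_eq x J (hJ j.castSucc) (hJ (Fin.last r))
    (Fin.castSucc_lt_last j).ne' (a * c j) n m
  refine ⟨∑ j, b j, funext fun J' => ?_⟩
  obtain rfl : J = J' := Subtype.ext (J.eq_univ.trans J'.eq_univ.symm)
  refine (isUnit_algebraMap_cechLoc x (hJ (Fin.last r)) n m).mul_left_cancel ?_
  calc _ = ∑ j, algebraMap A (CechLoc x J.1) (a * c j * x j.castSucc ^ n) := by
        rw [map_sum, Finset.sum_apply, Finset.mul_sum, Finset.sum_congr rfl fun j _ => hb j]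
    _ = algebraMap A (CechLoc x J.1) a * algebraMap A _ (t * x (Fin.last r) ^ m) := by
        rw [← map_mul, ← map_sum, ← hc, Finset.mul_sum]
        simp only [mul_assoc]
    _ = algebraMap A (CechLoc x J.1) ((∏ k ∈ J.1, x k) ^ n * x (Fin.last r) ^ m) *
          (t • w) J := by
        rw [← hw, Pi.smul_apply, Algebra.smul_def]
        simp only [map_mul]
        ring

theorem subsingleton_localizedModule_cechCohomology {x : Fin (r + 1) → A} {P : Ideal A}
    [P.IsPrime] {s : A} (hs : s ∉ P) {c : ℕ}
    (h : s * x (Fin.last r) ^ c ∈ Ideal.span (Set.range fun j : Fin r => x j.castSucc)) :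
    Subsingleton (LocalizedModule P.primeCompl (CechCohomology x (r + 1))) := by
  rw [LocalizedModule.subsingleton_iff]
  intro q
  obtain ⟨⟨w, hw⟩, rfl⟩ := Submodule.Quotient.mk_surjective _ q
  let J : Subsets (r + 1) (r + 1) := ⟨Finset.univ, Finset.card_fin _⟩
  obtain ⟨⟨a, _, n, rfl⟩, ha⟩ := IsLocalization.surj (Submonoid.powers (∏ k ∈ J.1, x k)) (w J)
  obtain ⟨N, m, hN⟩ := exists_pow_mul_pow_mem_span_pow h n
  refine ⟨s ^ N, fun hsP => hs (Ideal.IsPrime.mem_of_pow_mem ‹_› N hsP), ?_⟩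
  rw [← Submodule.Quotient.mk_smul, Submodule.Quotient.mk_eq_zero]
  exact smul_mem_range_cechD hN J ha

theorem exists_mul_pow_mem_of_mem_minimalPrimes {I P : Ideal A} (hP : P ∈ I.minimalPrimes) {z : A}
    (hz : z ∈ P) : ∃ s ∉ P, ∃ c : ℕ, s * z ^ c ∈ I := by
  have := hP.isPrime
  by_contra! hcon
  obtain ⟨Q, hQ, hIQ, hdisj⟩ := Ideal.exists_le_prime_disjoint I
    (P.primeCompl ⊔ Submonoid.powers z) <| Set.disjoint_right.2 fun t ht htI => by
      obtain ⟨s, hs, _, ⟨c, rfl⟩, rfl⟩ := Submonoid.mem_sup.1 ht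
      exact hcon s hs c htI
  rw [Set.disjoint_left] at hdisj
  have hQP : Q ≤ P := fun t ht => by
    by_contra htP
    exact hdisj ht (Submonoid.mem_sup_left htP)
  exact hdisj (hP.2 ⟨hQ, hIQ⟩ hQP hz) (Submonoid.mem_sup_right (Submonoid.mem_powers z))

end Cech

section HamiltonMarley

variable {A : Type*} [CommRing A] {r : ℕ}

theorem IsStrongParameterSeq.castSucc {x : Fin (r + 1) → A} (hx : IsStrongParameterSeq x) :
    IsStrongParameterSeq fun j : Fin r => x j.castSucc :=
  fun i hi => hx i (hi.trans r.le_succ)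

theorem IsStrongParameterSeq.isParameterSeq {x : Fin r → A} (hx : IsStrongParameterSeq x)
    (hr : 1 ≤ r) : IsParameterSeq x :=
  hx r le_rfl hr

theorem ofList_ofFn (x : Fin r → A) :
    Ideal.ofList (List.ofFn x) = Ideal.span (Set.range x) :=
  congrArg Ideal.span (Set.ext fun _ => List.mem_ofFn)

theorem IsParameterSeq.last_notMem {x : Fin (r + 1) → A} (hx : IsParameterSeq x) {P : Ideal A}
    (hP : P ∈ (Ideal.span (Set.range fun j : Fin r => x j.castSucc)).minimalPrimes) :
    x (Fin.last r) ∉ P := by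
  intro hlast
  have := hP.isPrime
  obtain ⟨s, hs, c, hsc⟩ := exists_mul_pow_mem_of_mem_minimalPrimes hP hlast
  have hxP : Ideal.span (Set.range x) ≤ P := by
    refine Ideal.span_le.2 (Set.range_subset_iff.2 <| Fin.lastCases hlast fun j => ?_)
    exact hP.le (Ideal.subset_span ⟨j, rfl⟩)
  exact not_nontrivial_iff_subsingleton.2 (subsingleton_localizedModule_cechCohomology hs hsc)
    (hx.cech_nontrivial P hxP)

theorem IsUnmixed.isWeaklyRegular_ofFn (hA : IsUnmixed A) {x : Fin r → A}
    (hx : IsStrongParameterSeq x) : IsWeaklyRegular A (List.ofFn x) := by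
  induction r with
  | zero => simp
  | succ r ih =>
    have hl := ih hx.castSucc
    rw [List.ofFn_succ', List.concat_eq_append, isWeaklyRegular_concat_iff]
    refine ⟨hl, hA.isSMulRegular hl fun P hP => ?_⟩
    rw [ofList_ofFn] at hP
    exact (hx.isParameterSeq r.succ_pos).last_notMem hP

theorem IsUnmixed.isHamiltonMarleyCM (hA : IsUnmixed A) : IsHamiltonMarleyCM A := by
  intro r x hr hx
  refine ⟨hA.isWeaklyRegular_ofFn hx, fun h => (hx.isParameterSeq hr).span_ne_top ?_⟩
  rw [← ofList_ofFn, ← Ideal.mul_top (Ideal.ofList _), ← smul_eq_mul]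
  exact h.symm

end HamiltonMarley

section Grade

universe u

variable {A : Type u} [CommRing A]

theorem IsUnmixed.height_eq_koszulGrade (hA : IsUnmixed A) (hA' : IsNoetherianApproximable A)
    (a : Ideal A) : a.height = koszulGrade a A :=
  (hA.height_le_koszulGrade a).antisymm (hA'.koszulGrade_le_height a)

theorem IsUnmixed.isGlazCM (hA : IsUnmixed A) (hA' : IsNoetherianApproximable A) :
    IsGlazCM A := by
  intro P _
  let B := Localization.AtPrime P
  refine le_antisymm (ENat.forall_natCast_le_iff_le.1 fun n hn => ?_) ?_
  · obtain ⟨l, hl, rfl, hlP⟩ := hA.exists_isWeaklyRegular hn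
    rw [← List.length_map (algebraMap A B)]
    refine length_le_koszulGrade hl.of_flat ?_
    rw [← Ideal.map_ofList]
    exact Ideal.map_mono hlP
  · calc koszulGrade (P.map (algebraMap A B)) B ≤ (P.map (algebraMap A B)).height :=
          (hA'.localization_atPrime P).koszulGrade_le_height _
      _ = P.height := IsLocalization.height_map_of_disjoint P.primeCompl P
          disjoint_compl_left

end Grade

end NonNoethCM

theorem theorem4p1_general {σ R : Type*} [CommRing R] [IsNoetherianRing R]
    (hR : NonNoethCM.IsClassicalCM R) :
    NonNoethCM.IsCMFor (MvPolynomial σ R) {p | p.IsPrime} ∧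
    NonNoethCM.IsCMFor (MvPolynomial σ R) Set.univ ∧
    NonNoethCM.IsGlazCM (MvPolynomial σ R) ∧
    NonNoethCM.IsCMFor (MvPolynomial σ R) {a | a.FG} ∧
    NonNoethCM.IsHamiltonMarleyCM (MvPolynomial σ R) ∧
    NonNoethCM.IsWeakBourbakiUnmixed (MvPolynomial σ R) ∧
    NonNoethCM.IsCMFor (MvPolynomial σ R) {m | m.IsMaximal} := by
  have hA := hR.isUnmixed.mvPolynomial σ
  have hA' := NonNoethCM.isNoetherianApproximable_mvPolynomial σ R
  have hgrade := hA.height_eq_koszulGrade hA'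
  exact ⟨fun a _ => hgrade a, fun a _ => hgrade a, hA.isGlazCM hA', fun a _ => hgrade a,
    hA.isHamiltonMarleyCM, hA.isWeakBourbakiUnmixed, fun a _ => hgrade a⟩

theorem theorem4p1 {R : Type*} [CommRing R] [IsNoetherianRing R]
    (hR : NonNoethCM.IsClassicalCM R) :
    NonNoethCM.IsCMFor (MvPolynomial ℕ R) {p | p.IsPrime} ∧
    NonNoethCM.IsCMFor (MvPolynomial ℕ R) Set.univ ∧
    NonNoethCM.IsGlazCM (MvPolynomial ℕ R) ∧
    NonNoethCM.IsCMFor (MvPolynomial ℕ R) {a | a.FG} ∧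
    NonNoethCM.IsHamiltonMarleyCM (MvPolynomial ℕ R) ∧
    NonNoethCM.IsWeakBourbakiUnmixed (MvPolynomial ℕ R) ∧
    NonNoethCM.IsCMFor (MvPolynomial ℕ R) {m | m.IsMaximal} :=
  theorem4p1_general hR
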